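/- **Setting.** Consider $\mathbb R^4$ with coordinates $(x_1,x_2,y_1,y_2)$ and symplectic form $\omega=dx_1\wedge dy_1+dx_2\wedge dy_2$; let $L_0=\{y_1=y_2=0\}$. A *flat-at-infinity planar Lagrangian* is an embedded Lagrangian submanifold $L\subset\mathbb R^4$ that is diffeomorphic to $\mathbb R^2$ and agrees with $L_0$ outside a compact subset of $\mathbb R^4$. Put $L_a=L\cap\{y_2=a\}$, and let $i_a:\mathbb R^3\to\{y_2=a\}\subset\mathbb R^4$, $(x_1,x_2,y_1)\mapsto(x_1,x_2,y_1,a)$. A link $S\subset\mathbb R^3$ (a finite disjoint union of smoothly embedded circles) is a *negative slice* if there are $a<0$ and a flat-at-infinity planar Lagrangian $L$ that is transverse to $\{y_2=a\}$ and satisfies $L_a=i_a(S)$. Let $\widetilde{\mathcal S}$ be the set of all negative slices together with the empty set. For $S,T\subset\mathbb R^3$ write $S\sim T$ if $(\varphi\times\mathrm{id})(S)=T$ for some compactly supported area-preserving diffeomorphism $\varphi$ of the $x_1y_1$-plane (here $\mathrm{id}$ is the identity in the $x_2$-coordinate), and let $\mathcal S=\widetilde{\mathcal S}/{\sim}$.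 The sum of $\mathbf S,\mathbf S'\in\mathcal S$ is $\mathbf S+\mathbf S'=[S\cup S']$, where $S\in\mathbf S$ and $S'\in\mathbf S'$ are representatives with $S\subset\{x_1<0\}$ and $S'\subset\{x_1>0\}$. A *connect sum* $L\#L'$ of two flat-at-infinity planar Lagrangians that agree with $L_0$ outside compact sets $K$ and $K'$, respectively, is any set $(\tau(L)\cap\{x_1\le0\})\cup(\tau'(L')\cap\{x_1\ge0\})$, where $\tau,\tau'$ are translations in the $x_1$-direction with $\tau(K)\subset\{x_1<0\}$ and $\tau'(K')\subset\{x_1>0\}$. A *Hamiltonian diffeomorphism* of $\mathbb R^4$ is the time-one map of a smooth isotopy $(\Phi_t)$ with $\Phi_0=\mathrm{id}$ that is generated by a smooth (time-dependent) Hamiltonian function. **Proposition 2.1.** Every class in $\mathcal S$ has a representative in $\{x_1<0\}$ and a representative in $\{x_1>0\}$. Moreover, for all $\mathbf S,\mathbf S'\in\mathcal S$: 1. The sum $\mathbf S+\mathbf S'$ does not depend on the choice of representatives: if $S,\bar S\in\mathbf S$ lie in $\{x_1<0\}$ and $S',\bar S'\in\mathbf S'$ lie in $\{x_1>0\}$,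 then $S\cup S'\sim\bar S\cup\bar S'$. 2. The sum $\mathbf S+\mathbf S'$ is again an element of $\mathcal S$: for all such $S$ and $S'$, $S\cup S'\in\widetilde{\mathcal S}$. It is realized by connect sums, in the following sense. Let $a,b<0$, and let $L,L'$ be flat-at-infinity planar Lagrangians, transverse to $\{y_2=a\}$ and to $\{y_2=b\}$, respectively, such that $L_a=i_a(S)$ and $L'_b=i_b(S')$ with $S\in\mathbf S$ and $S'\in\mathbf S'$ (not necessarily in the half-spaces above). Then there is a Hamiltonian diffeomorphism $\psi$ of $\mathbb R^4$ that is the identity on $\{y_2\ge\beta\}$ for some $\beta$ with $b<\beta<0$, and is the translation by $a-b$ in the $y_2$-direction on $\{y_2\le b\}$, such that $\psi(L')$ is a flat-at-infinity planar Lagrangian, a connect sum of $L$ and $\psi(L')$ exists, and every connect sum $M=L\#\psi(L')$ is a flat-at-infinity planar Lagrangian that is transverse to $\{y_2=a\}$ and satisfies $M_a=i_a(T)$ for a representative $T$ of $\mathbf S+\mathbf S'$. -/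

import Mathlib

open Set Topology
open scoped Manifold ContDiff

namespace PlanarSlices

/-- Three-space with coordinates `(x₁, x₂, y₁)`. -/
abbrev R3 : Type := ℝ × ℝ × ℝ

/-- Four-space with coordinates `(x₁, x₂, y₁, y₂)`. -/
abbrev R4 : Type := ℝ × ℝ × ℝ × ℝ

/-- The `y₂`-coordinate on four-space. -/
def y2 (p : R4) : ℝ := p.2.2.2

/-- The standard symplectic form `dx₁ ∧ dy₁ + dx₂ ∧ dy₂`. -/
def omega (u v : R4) : ℝ :=
  (u.1 * v.2.2.1 - u.2.2.1 * v.1) + (u.2.1 * v.2.2.2 - u.2.2.2 * v.2.1)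

/-- The Lagrangian `x₁x₂`-plane. -/
def L0 : Set R4 := {p | p.2.2.1 = 0 ∧ p.2.2.2 = 0}

/-- `v` is tangent to `L` at `p`: it is the velocity at time `0` of a smooth curve through `p`
that stays in `L` for small times. For an embedded submanifold these vectors form `T_p L`. -/
def IsTangent (L : Set R4) (p v : R4) : Prop :=
  ∃ c : ℝ → R4, ContDiff ℝ ∞ c ∧ c 0 = p ∧ (∀ᶠ t in 𝓝 (0 : ℝ), c t ∈ L) ∧ deriv c 0 = v

/-- `L` is an embedded submanifold diffeomorphic to `ℝ²`, that is, the image of a smooth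
embedding of `ℝ²`. -/
def IsEmbeddedPlane (L : Set R4) : Prop :=
  ∃ f : ℝ × ℝ → R4, ContDiff ℝ ∞ f ∧ (∀ q, Function.Injective (fderiv ℝ f q)) ∧
    IsEmbedding f ∧ range f = L

/-- `L` is an embedded Lagrangian submanifold that is diffeomorphic to `ℝ²`. -/
def IsPlanarLagrangian (L : Set R4) : Prop :=
  IsEmbeddedPlane L ∧ ∀ p ∈ L, ∀ u v, IsTangent L p u → IsTangent L p v → omega u v = 0

/-- `L` agrees with the `x₁x₂`-plane outside `K`. -/
def AgreesOutside (L K : Set R4) : Prop := L \ K = L0 \ K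

/-- Flat-at-infinity planar Lagrangians. -/
def IsFlatPlanarLagrangian (L : Set R4) : Prop :=
  IsPlanarLagrangian L ∧ ∃ K : Set R4, IsCompact K ∧ AgreesOutside L K

/-- The intersection `L_a` of `L` with the hyperplane `{y₂ = a}`. -/
def level (L : Set R4) (a : ℝ) : Set R4 := {p ∈ L | y2 p = a}

/-- `L` is transverse to the hyperplane `{y₂ = a}`: at no common point is the tangent space of `L`
contained in that of the hyperplane. -/
def IsTransverse (L : Set R4) (a : ℝ) : Prop :=
  ∀ p ∈ level L a, ∃ v, IsTangent L p v ∧ y2 v ≠ 0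

/-- The inclusion of three-space as the hyperplane `{y₂ = a}`. -/
def incl (a : ℝ) (p : R3) : R4 := (p.1, p.2.1, p.2.2, a)

/-- A link: a finite disjoint union of smoothly embedded circles, each of them parametrized by a
`1`-periodic function. -/
def IsLink (S : Set R3) : Prop :=
  ∃ (n : ℕ) (γ : Fin n → ℝ → R3),
    (∀ i, ContDiff ℝ ∞ (γ i) ∧ Function.Periodic (γ i) 1 ∧ (∀ t, deriv (γ i) t ≠ 0) ∧
      InjOn (γ i) (Ico 0 1)) ∧
    (∀ i j, i ≠ j → Disjoint (range (γ i)) (range (γ j))) ∧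
    S = ⋃ i, range (γ i)

/-- The link `S` is a (generic) negative Lagrangian slice. -/
def IsNegativeSlice (S : Set R3) : Prop :=
  IsLink S ∧ ∃ (L : Set R4) (a : ℝ), a < 0 ∧ IsFlatPlanarLagrangian L ∧ IsTransverse L a ∧
    level L a = incl a '' S

/-- The set of all negative Lagrangian slices together with the empty set. -/
def Slices : Set (Set R3) := {S | IsNegativeSlice S} ∪ {∅}

/-- A compactly supported area-preserving diffeomorphism of the `x₁y₁`-plane. (The determinant
is `1` and not `-1`, because the map is the identity outside a compact set.) -/
def IsCompactAreaPreserving (φ : (ℝ × ℝ) ≃ₘ[ℝ] (ℝ × ℝ)) : Prop :=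
  (∃ K : Set (ℝ × ℝ), IsCompact K ∧ ∀ p ∉ K, φ p = p) ∧ ∀ p, (fderiv ℝ φ p).det = 1

/-- The map `φ × id` of three-space, where `φ` acts on the coordinates `(x₁, y₁)` and the identity
on the coordinate `x₂`. -/
def timesId (φ : ℝ × ℝ → ℝ × ℝ) (p : R3) : R3 :=
  ((φ (p.1, p.2.2)).1, p.2.1, (φ (p.1, p.2.2)).2)

/-- The relation `S ∼ T`. -/
def SliceEquiv (S T : Set R3) : Prop :=
  ∃ φ : (ℝ × ℝ) ≃ₘ[ℝ] (ℝ × ℝ), IsCompactAreaPreserving φ ∧ timesId φ '' S = T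

theorem sliceEquiv_refl (S : Set R3) : SliceEquiv S S := by
  refine ⟨Diffeomorph.refl _ _ _, ⟨⟨∅, isCompact_empty, fun p _ => rfl⟩, fun p => ?_⟩, ?_⟩
  · have : (⇑(Diffeomorph.refl 𝓘(ℝ, ℝ × ℝ) (ℝ × ℝ) ∞)) = id := rfl
    rw [this, fderiv_id]
    simp [ContinuousLinearMap.det]
  · have : timesId (Diffeomorph.refl 𝓘(ℝ, ℝ × ℝ) (ℝ × ℝ) ∞) = id := rfl
    rw [this, image_id]

theorem sliceEquiv_trans {S T U : Set R3} (h : SliceEquiv S T) (h' : SliceEquiv T U) :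
    SliceEquiv S U := by
  obtain ⟨φ, ⟨⟨K, hK, hφ⟩, hd⟩, rfl⟩ := h
  obtain ⟨χ, ⟨⟨K', hK', hχ⟩, hd'⟩, rfl⟩ := h'
  refine ⟨φ.trans χ, ⟨⟨K ∪ K', hK.union hK', fun p hp => ?_⟩, fun p => ?_⟩, ?_⟩
  · rw [mem_union, not_or] at hp
    rw [Diffeomorph.coe_trans, Function.comp_apply, hφ p hp.1, hχ p hp.2]
  · have h1 : DifferentiableAt ℝ φ p := φ.contDiff.differentiable (by simp) p
    have h2 : DifferentiableAt ℝ χ (φ p) := χ.contDiff.differentiable (by simp) (φ p)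
    rw [Diffeomorph.coe_trans, fderiv_comp p h2 h1, ContinuousLinearMap.det,
      ContinuousLinearMap.toLinearMap_comp, LinearMap.det_comp]
    have e1 := hd p
    have e2 := hd' (φ p)
    rw [ContinuousLinearMap.det] at e1 e2
    rw [e1, e2, one_mul]
  · rw [← image_comp]
    rfl

theorem sliceEquiv_symm {S T : Set R3} (h : SliceEquiv S T) : SliceEquiv T S := by
  obtain ⟨φ, ⟨⟨K, hK, hφ⟩, hd⟩, rfl⟩ := h
  refine ⟨φ.symm, ⟨⟨K, hK, fun p hp => ?_⟩, fun p => ?_⟩, ?_⟩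
  · have h1 := congrArg φ.symm (hφ p hp)
    rw [φ.symm_apply_apply] at h1
    exact h1.symm
  · have h1 : DifferentiableAt ℝ φ.symm p := φ.symm.contDiff.differentiable (by simp) p
    have h2 : DifferentiableAt ℝ φ (φ.symm p) := φ.contDiff.differentiable (by simp) _
    have h3 := fderiv_comp p h2 h1
    have h4 : (⇑φ ∘ ⇑φ.symm) = id := funext fun q => φ.apply_symm_apply q
    rw [h4, fderiv_id] at h3
    have h5 : LinearMap.det ((ContinuousLinearMap.id ℝ (ℝ × ℝ)) : (ℝ × ℝ) →ₗ[ℝ] (ℝ × ℝ)) =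
        LinearMap.det ((fderiv ℝ φ (φ.symm p) ∘SL fderiv ℝ φ.symm p) : (ℝ × ℝ) →ₗ[ℝ] (ℝ × ℝ)) :=
      by rw [h3]
    have e1 := hd (φ.symm p)
    rw [ContinuousLinearMap.det] at e1
    rw [ContinuousLinearMap.toLinearMap_comp, LinearMap.det_comp, e1, one_mul] at h5
    exact h5.symm.trans LinearMap.det_id
  · rw [← image_comp]
    have : timesId φ.symm ∘ timesId φ = id := by
      funext p
      simp [timesId]
    rw [this, image_id]

/-- The relation `∼` as an equivalence relation on the set of slices. -/
def sliceSetoid : Setoid Slices where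
  r S T := SliceEquiv S.1 T.1
  iseqv := ⟨fun S => sliceEquiv_refl S.1, sliceEquiv_symm, sliceEquiv_trans⟩

/-- The set of equivalence classes of slices. -/
abbrev SliceClass : Type := Quotient sliceSetoid

/-- `S` is a representative of the class `s`. -/
def Represents (S : Set R3) (s : SliceClass) : Prop :=
  ∃ h : S ∈ Slices, Quotient.mk sliceSetoid ⟨S, h⟩ = s

/-- `S` is a representative of the class `s` contained in `{x₁ < 0}`. -/
def RepresentsLeft (S : Set R3) (s : SliceClass) : Prop :=
  Represents S s ∧ S ⊆ {p | p.1 < 0}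

/-- `S` is a representative of the class `s` contained in `{x₁ > 0}`. -/
def RepresentsRight (S : Set R3) (s : SliceClass) : Prop :=
  Represents S s ∧ S ⊆ {p | 0 < p.1}

/-- `ψ` is a Hamiltonian diffeomorphism of four-space: the time-one map of the isotopy `Φ` that
is generated by a smooth time-dependent Hamiltonian function `H` through `ω(dΦ/dt, ·) = dH_t`. -/
def IsHamiltonianDiffeo (ψ : R4 ≃ₘ[ℝ] R4) : Prop :=
  ∃ (H : ℝ × R4 → ℝ) (Φ : ℝ → R4 ≃ₘ[ℝ] R4),
    ContDiff ℝ ∞ H ∧ ContDiff ℝ ∞ (fun z : ℝ × R4 => Φ z.1 z.2) ∧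
    (∀ p, Φ 0 p = p) ∧ (∀ p, Φ 1 p = ψ p) ∧
    ∀ t p v, omega (deriv (fun s => Φ s p) t) v = fderiv ℝ (fun q => H (t, q)) (Φ t p) v

/-- Translation by `t` in the `x₁`-direction. -/
def translateX1 (t : ℝ) (p : R4) : R4 := (p.1 + t, p.2.1, p.2.2.1, p.2.2.2)

/-- `M` is a connect sum `L # L'`. -/
def IsConnectSum (L L' M : Set R4) : Prop :=
  ∃ (K K' : Set R4) (t t' : ℝ), IsCompact K ∧ AgreesOutside L K ∧
    IsCompact K' ∧ AgreesOutside L' K' ∧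
    translateX1 t '' K ⊆ {p | p.1 < 0} ∧ translateX1 t' '' K' ⊆ {p | 0 < p.1} ∧
    M = (translateX1 t '' L ∩ {p | p.1 ≤ 0}) ∪ (translateX1 t' '' L' ∩ {p | 0 ≤ p.1})

/-- `ψ` shifts the level `b` to the level `a`: it is the identity on `{y₂ ≥ β}` for some
`b < β < 0`, and the translation by `a - b` in the `y₂`-direction on `{y₂ ≤ b}`. -/
def ShiftsLevel (ψ : R4 → R4) (b a : ℝ) : Prop :=
  (∃ β : ℝ, b < β ∧ β < 0 ∧ ∀ p, β ≤ y2 p → ψ p = p) ∧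
    ∀ p, y2 p ≤ b → ψ p = (p.1, p.2.1, p.2.2.1, p.2.2.2 + (a - b))

end PlanarSlices

namespace PlanarSlices

/-! Everything rests on one construction. An increasing diffeomorphism `h` of a line lifts to the
area-preserving map (x, y) ↦ (h(x), y / h'(x)) of the plane (`liftPlane`), which preserves the zero
section and is the identity over any open set where `h` is. Applied in one symplectic coordinate
pair of four-space, it gives a symplectic map.

Representatives: on a compact set, a translation in the x₁-direction is the product of two point
reflections, and each of these extends to a compactly supported area-preserving twist. So
translating a slice does not change its class (`sliceEquiv_translate`).

Independence: an equivalence between two slices in {x₁ < 0} may have support that crosses x₁ = 0.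
Conjugating by the lift of an `h` that fixes the slices and pushes the support to the left confines
it to {x₁ < 0}. Equivalences confined to opposite sides have disjoint supports and can be composed
(`SliceEquiv.union`).

Connect sums: lifting an isotopy of the y₂-line that is stationary near 0 and above gives a
Hamiltonian isotopy that brings level b to level a and fixes `L0` (`exists_levelShift`). Lifts in
the x₁-direction make a Lagrangian flat outside the half-space of its slice, again without moving
the slice. The two halves then match along a flat strip, so that near every point their union
coincides with one of the two Lagrangians; the Lagrangian condition and transversality are inherited
(`halves_properties`).

The global point is that the union is again one embedded plane (`isEmbeddedPlane_halves`). The first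
plane is reparametrized so that it is standard over a small disc of its flat part; the non-flat part
of the second is squeezed over this disc, and its parametrization is inserted there
(`IsPlaneParam.glue`). -/

/-! ### Diffeomorphisms of the line with prescribed ends -/

/-- A smooth bijection with invertible derivatives is a diffeomorphism. -/
theorem exists_diffeomorph_of_bijective {E : Type*} [NormedAddCommGroup E] [NormedSpace ℝ E]
    [CompleteSpace E] {f : E → E} (hf : ContDiff ℝ ∞ f) (hb : Function.Bijective f)
    (hd : ∀ x, ∃ A : E ≃L[ℝ] E, HasFDerivAt f (A : E →L[ℝ] E) x) :
    ∃ Φ : E ≃ₘ[ℝ] E, ⇑Φ = f := by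
  let e : E ≃ E := Equiv.ofBijective f hb
  have hinv : ContDiff ℝ ∞ e.symm := by
    rw [contDiff_iff_contDiffAt]
    intro y
    obtain ⟨x, rfl⟩ := hb.2 y
    obtain ⟨A, hA⟩ := hd x
    have hfx : ContDiffAt ℝ ∞ f x := hf.contDiffAt
    have h1 := hfx.to_localInverse hA (by simp)
    refine h1.congr_of_eventuallyEq ?_
    have h2 := (hfx.hasStrictFDerivAt' hA (by simp)).eventually_right_inverse
    filter_upwards [h2] with z hz
    apply hb.1
    exact (e.apply_symm_apply z).trans hz.symm
  exact ⟨⟨e, hf.contMDiff, hinv.contMDiff⟩, rfl⟩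

/-- A smooth real function with positive derivative that stays at bounded distance from the
identity is a diffeomorphism. -/
theorem exists_diffeomorph_real {f : ℝ → ℝ} (hf : ContDiff ℝ ∞ f) (hd : ∀ x, 0 < deriv f x)
    {C : ℝ} (hC : ∀ x, |f x - x| ≤ C) : ∃ Φ : ℝ ≃ₘ[ℝ] ℝ, ⇑Φ = f := by
  have hmono : StrictMono f := strictMono_of_deriv_pos hd
  refine exists_diffeomorph_of_bijective hf ⟨hmono.injective, ?_⟩ fun x => ?_
  · apply hf.continuous.surjective
    · refine Filter.tendsto_atTop_mono (f := fun x => x - C) (fun x => ?_)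
        (Filter.tendsto_atTop_add_const_right _ _ Filter.tendsto_id)
      have := (abs_le.1 (hC x)).1
      linarith
    · refine Filter.tendsto_atBot_mono (f := fun x => x + C) (fun x => ?_)
        (Filter.tendsto_atBot_add_const_right _ _ Filter.tendsto_id)
      have := (abs_le.1 (hC x)).2
      linarith
  · refine ⟨ContinuousLinearEquiv.unitsEquivAut ℝ (Units.mk0 _ (hd x).ne'), ?_⟩
    have h1 := (hf.differentiable (by simp) x).hasDerivAt.hasFDerivAt
    refine HasFDerivAt.congr_fderiv h1 ?_
    ext
    simp

theorem deriv_diffeomorph_symm_pos {h : ℝ ≃ₘ[ℝ] ℝ} (hd : ∀ x, 0 < deriv h x) (y : ℝ) :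
    0 < deriv h.symm y := by
  have h1 : HasDerivAt h (deriv h (h.symm y)) (h.symm y) :=
    (h.contDiff.differentiable (by simp) _).hasDerivAt
  have h2 : HasDerivAt h.symm (deriv h.symm y) y :=
    (h.symm.contDiff.differentiable (by simp) _).hasDerivAt
  have h3 := h1.comp y h2
  have h4 : (⇑h ∘ ⇑h.symm) = id := funext fun q => h.apply_symm_apply q
  rw [h4] at h3
  have h5 := h3.unique (hasDerivAt_id y)
  have := hd (h.symm y)
  by_contra hc
  have := mul_nonpos_of_nonneg_of_nonpos this.le (not_lt.1 hc)
  linarith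

theorem smoothTransition_deriv_nonneg (x : ℝ) : 0 ≤ deriv Real.smoothTransition x :=
  Real.smoothTransition.monotone.deriv_nonneg

/-- For a shift to the right the interpolation has derivative at least 1, however steep the
transition is. Shifts to the left are obtained as inverses of such maps. -/
theorem exists_shift_of_le {u c c' : ℝ} (h : u < c) (h' : c ≤ c') :
    ∃ f : ℝ ≃ₘ[ℝ] ℝ, (∀ x, 0 < deriv f x) ∧ (∀ x ≤ u, f x = x) ∧
      ∀ x, c ≤ x → f x = x + (c' - c) := by
  let f : ℝ → ℝ := fun x => x + (c' - c) * Real.smoothTransition ((x - u) / (c - u))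
  have hs : ContDiff ℝ ∞ Real.smoothTransition := Real.smoothTransition.contDiff
  have hf : ContDiff ℝ ∞ f := by
    refine contDiff_id.add (contDiff_const.mul (hs.comp ?_))
    exact (contDiff_id.sub contDiff_const).div_const _
  have hcu : 0 < c - u := by linarith
  have hd : ∀ x, 0 < deriv f x := by
    intro x
    have h1 : HasDerivAt (fun x : ℝ => (x - u) / (c - u)) (1 / (c - u)) x :=
      ((hasDerivAt_id x).sub_const u).div_const _
    have h2 := ((hs.differentiable (by simp) ((x - u) / (c - u))).hasDerivAt.comp x h1)
    have h3 := (hasDerivAt_id x).add (h2.const_mul (c' - c))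
    have h4 : deriv f x = _ := h3.deriv
    rw [h4]
    have := smoothTransition_deriv_nonneg ((x - u) / (c - u))
    have h5 : 0 ≤ c' - c := by linarith
    positivity
  have hC : ∀ x, |f x - x| ≤ c' - c := by
    intro x
    have h0 := Real.smoothTransition.nonneg ((x - u) / (c - u))
    have h1 := Real.smoothTransition.le_one ((x - u) / (c - u))
    have : f x - x = (c' - c) * Real.smoothTransition ((x - u) / (c - u)) := by
      simp [f]
    rw [this, abs_of_nonneg (mul_nonneg (by linarith) h0)]
    nlinarith
  obtain ⟨Φ, hΦ⟩ := exists_diffeomorph_real hf hd hC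
  refine ⟨Φ, by rwa [hΦ], fun x hx => ?_, fun x hx => ?_⟩
  · rw [hΦ]
    have : (x - u) / (c - u) ≤ 0 := div_nonpos_of_nonpos_of_nonneg (by linarith) hcu.le
    simp [f, Real.smoothTransition.zero_of_nonpos this]
  · rw [hΦ]
    have : 1 ≤ (x - u) / (c - u) := by rw [le_div_iff₀ hcu]; linarith
    simp [f, Real.smoothTransition.one_of_one_le this]

/-- There is an increasing diffeomorphism of the line that is the identity to the left of `u` and
the translation by `c' - c` to the right of `c`. -/
theorem exists_shift {u c c' : ℝ} (h : u < c) (h' : u < c') :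
    ∃ f : ℝ ≃ₘ[ℝ] ℝ, (∀ x, 0 < deriv f x) ∧ (∀ x ≤ u, f x = x) ∧
      ∀ x, c ≤ x → f x = x + (c' - c) := by
  rcases le_total c c' with hc | hc
  · exact exists_shift_of_le h hc
  · obtain ⟨f, hd, h1, h2⟩ := exists_shift_of_le h' hc
    refine ⟨f.symm, deriv_diffeomorph_symm_pos hd, fun x hx => ?_, fun x hx => ?_⟩
    · refine f.injective (show f (f.symm x) = f x from ?_)
      rw [f.apply_symm_apply, h1 x hx]
    · refine f.injective (show f (f.symm x) = f _ from ?_)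
      rw [f.apply_symm_apply, h2 _ (by linarith)]
      ring

/-- The mirror image of `exists_shift`. -/
theorem exists_shift_left {u c c' : ℝ} (h : c < u) (h' : c' < u) :
    ∃ f : ℝ ≃ₘ[ℝ] ℝ, (∀ x, 0 < deriv f x) ∧ (∀ x, u ≤ x → f x = x) ∧
      ∀ x ≤ c, f x = x + (c' - c) := by
  obtain ⟨f, hd, h1, h2⟩ := exists_shift (neg_lt_neg h) (neg_lt_neg h')
  let N : ℝ ≃ₘ[ℝ] ℝ := ⟨Equiv.neg ℝ, contDiff_neg.contMDiff, contDiff_neg.contMDiff⟩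
  have hN : ∀ x, N x = -x := fun x => rfl
  have hcoe : ⇑((N.trans f).trans N) = fun x => -f (-x) := rfl
  refine ⟨(N.trans f).trans N, fun x => ?_, fun x hx => ?_, fun x hx => ?_⟩
  · rw [hcoe, deriv.fun_neg, deriv_comp_neg]
    simpa using hd (-x)
  · rw [hcoe]
    simp [h1 (-x) (by linarith)]
  · rw [hcoe]
    simp only [h2 (-x) (by linarith)]
    ring

/-! ### Extending the germ of a local diffeomorphism -/

theorem continuousLinearMap_det_prod (A : ℝ × ℝ →L[ℝ] ℝ × ℝ) :
    A.det = (A (1, 0)).1 * (A (0, 1)).2 - (A (0, 1)).1 * (A (1, 0)).2 := by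
  rw [ContinuousLinearMap.det, ← LinearMap.det_toMatrix (Module.Basis.finTwoProd ℝ),
    Matrix.det_fin_two]
  simp [LinearMap.toMatrix_apply]

theorem exists_continuousLinearEquiv_of_injective {E : Type*} [NormedAddCommGroup E]
    [NormedSpace ℝ E] [FiniteDimensional ℝ E] (A : E →L[ℝ] E) (hA : Function.Injective A) :
    ∃ B : E ≃L[ℝ] E, (B : E →L[ℝ] E) = A :=
  ⟨(LinearEquiv.ofInjectiveEndo (A : E →ₗ[ℝ] E) hA).toContinuousLinearEquiv, by ext; rfl⟩

/-- A smooth map agrees near a point where its derivative is invertible with a global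
diffeomorphism. -/
theorem exists_diffeomorph_eventuallyEq {E : Type*} [NormedAddCommGroup E] [NormedSpace ℝ E]
    [FiniteDimensional ℝ E] {φ : E → E} (hφ : ContDiff ℝ ∞ φ) {q : E} (A : E ≃L[ℝ] E)
    (hA : HasFDerivAt φ (A : E →L[ℝ] E) q) : ∃ Γ : E ≃ₘ[ℝ] E, ⇑Γ =ᶠ[𝓝 q] φ := by
  have : CompleteSpace E := FiniteDimensional.complete ℝ E
  -- the antilipschitz constant of `A`
  obtain ⟨N, hN0, hN, hNc⟩ : ∃ N : NNReal, 0 < N ∧ (∀ v, ‖v‖ ≤ N * ‖A v‖) ∧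
      (Subsingleton E ∨ 1 / (2 * N) < ‖(A.symm : E →L[ℝ] E)‖₊⁻¹) := by
    -- The summand 1 keeps N positive on the trivial space as well. Since 2N exceeds ‖A⁻¹‖, a
    -- perturbation of A with Lipschitz constant 1/(2N) is still bijective.
    refine ⟨‖(A.symm : E →L[ℝ] E)‖₊ + 1, by positivity, fun v => ?_,
      A.subsingleton_or_nnnorm_symm_pos.imp_right fun h => ?_⟩
    swap
    · rw [one_div]
      apply inv_strictAnti₀ h
      rw [← NNReal.coe_lt_coe]
      push_cast
      linarith [norm_nonneg (A.symm : E →L[ℝ] E)]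
    have h1 := (A.symm : E →L[ℝ] E).le_opNorm (A v)
    simp only [ContinuousLinearEquiv.coe_coe, ContinuousLinearEquiv.symm_apply_apply] at h1
    push_cast
    nlinarith [norm_nonneg (A v)]
  let χ : ContDiffBump (0 : E) := ⟨1, 2, by norm_num, by norm_num⟩
  have hχs : ContDiff ℝ ∞ χ := χ.contDiff
  obtain ⟨C, hC0, hC⟩ : ∃ C : ℝ, 0 < C ∧ ∀ x, ‖fderiv ℝ χ x‖ ≤ C := by
    obtain ⟨C, hC⟩ := (χ.hasCompactSupport.fderiv ℝ).exists_bound_of_continuous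
      (hχs.continuous_fderiv (by simp))
    exact ⟨max C 1, by positivity, fun x => (hC x).trans (le_max_left _ _)⟩
  -- The remainder of the first-order expansion: it vanishes at q together with its derivative.
  let r : E → E := fun x => φ x - φ q - A (x - q)
  have hr : ContDiff ℝ ∞ r :=
    (hφ.sub contDiff_const).sub (A.contDiff.comp (contDiff_id.sub contDiff_const))
  have hr0 : r q = 0 := by simp [r]
  have hdr0 : fderiv ℝ r q = 0 := by
    have h1 : HasFDerivAt (fun x => A (x - q)) (A : E →L[ℝ] E) q := by
      have := (A : E →L[ℝ] E).hasFDerivAt (x := q - q)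
      have h2 := HasFDerivAt.comp (f := fun x => x - q) q this ((hasFDerivAt_id q).sub_const q)
      rw [ContinuousLinearMap.comp_id] at h2
      exact h2
    have := (hA.sub_const (φ q)).sub h1
    rw [sub_self] at this
    exact this.fderiv
  -- Chosen so that κ + (C/δ)·κ·3δ = 1/(2N), where the two terms bound s·r' and s'·r. The radius δ
  -- cancels, so it can be chosen after κ.
  let κ : ℝ := 1 / (2 * N * (1 + 3 * C))
  have hN0' : (0 : ℝ) < N := hN0
  have hκ : 0 < κ := by positivity
  obtain ⟨δ, hδ, hball⟩ : ∃ δ > 0, ∀ x ∈ Metric.ball q (3 * δ), ‖fderiv ℝ r x‖ ≤ κ := by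
    have h1 : Continuous fun x => ‖fderiv ℝ r x‖ := (hr.continuous_fderiv (by simp)).norm
    have h2 : ∀ᶠ x in 𝓝 q, ‖fderiv ℝ r x‖ < κ := by
      apply h1.continuousAt.eventually_lt continuousAt_const
      simpa [hdr0] using hκ
    obtain ⟨δ, hδ, h3⟩ := Metric.eventually_nhds_iff_ball.1 h2
    refine ⟨δ / 3, by positivity, fun x hx => (h3 x ?_).le⟩
    convert hx using 2
    ring
  have hrb : ∀ x ∈ Metric.ball q (3 * δ), ‖r x‖ ≤ κ * ‖x - q‖ := by
    intro x hx
    have := (convex_ball q (3 * δ)).norm_image_sub_le_of_norm_fderiv_le (𝕜 := ℝ) (f := r)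
      (fun y _ => hr.differentiable (by simp) y) hball
      (Metric.mem_ball_self (by positivity)) hx
    simpa [hr0] using this
  let s : E → ℝ := fun x => χ (δ⁻¹ • (x - q))
  have hs : ContDiff ℝ ∞ s := hχs.comp (contDiff_const.smul (contDiff_id.sub contDiff_const))
  have hsd : ∀ x, ‖fderiv ℝ s x‖ ≤ C / δ := by
    intro x
    have h1 : HasFDerivAt (fun x : E => δ⁻¹ • (x - q)) (δ⁻¹ • ContinuousLinearMap.id ℝ E) x :=
      ((hasFDerivAt_id x).sub_const q).const_smul _
    have h2 := (hχs.differentiable (by simp) (δ⁻¹ • (x - q))).hasFDerivAt.comp x h1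
    have h3 : fderiv ℝ s x = _ := h2.fderiv
    rw [h3, ContinuousLinearMap.comp_smul, norm_smul, ContinuousLinearMap.comp_id, norm_inv,
      Real.norm_of_nonneg hδ.le, div_eq_inv_mul]
    exact mul_le_mul_of_nonneg_left (hC _) (by positivity)
  have hs0 : ∀ x, 2 * δ ≤ ‖x - q‖ → s x = 0 := by
    intro x hx
    apply χ.zero_of_le_dist
    rw [dist_zero_right, norm_smul, norm_inv, Real.norm_of_nonneg hδ.le, ← div_eq_inv_mul]
    exact (le_div_iff₀ hδ).2 hx
  have hs1 : ∀ x, ‖x - q‖ ≤ δ → s x = 1 := by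
    intro x hx
    apply χ.one_of_mem_closedBall
    rw [mem_closedBall_zero_iff, norm_smul, norm_inv, Real.norm_of_nonneg hδ.le, ← div_eq_inv_mul]
    exact (div_le_one hδ).2 hx
  let w : E → E := fun x => s x • r x
  have hw : ContDiff ℝ ∞ w := hs.smul hr
  have hwd : ∀ x, ‖fderiv ℝ w x‖ ≤ 1 / (2 * N) := by
    intro x
    rcases lt_or_ge ‖x - q‖ (3 * δ) with hx | hx
    · have hxb : x ∈ Metric.ball q (3 * δ) := by rwa [mem_ball_iff_norm]
      have h1 : HasFDerivAt w _ x := (hs.differentiable (by simp) x).hasFDerivAt.smul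
        (hr.differentiable (by simp) x).hasFDerivAt
      have hsx : ‖s x‖ ≤ 1 := by
        rw [Real.norm_of_nonneg χ.nonneg]
        exact χ.le_one
      have h2 : fderiv ℝ w x = _ := h1.fderiv
      have h3 : ‖s x • fderiv ℝ r x‖ ≤ κ := by
        rw [norm_smul]
        nlinarith [hball x hxb, norm_nonneg (fderiv ℝ r x), norm_nonneg (s x)]
      have h4 : ‖(fderiv ℝ s x).smulRight (r x)‖ ≤ C / δ * (κ * (3 * δ)) := by
        rw [ContinuousLinearMap.norm_smulRight_apply]
        exact mul_le_mul (hsd x) ((hrb x hxb).trans (by gcongr)) (norm_nonneg _) (by positivity)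
      rw [h2]
      refine (norm_add_le _ _).trans ((add_le_add h3 h4).trans (le_of_eq ?_))
      simp only [κ]
      field_simp
    · have h0 : w =ᶠ[𝓝 x] fun _ => 0 := by
        have h1 : ∀ᶠ y in 𝓝 x, 2 * δ < ‖y - q‖ := by
          apply continuousAt_const.eventually_lt (by fun_prop)
          linarith
        filter_upwards [h1] with y hy
        simp [w, hs0 y hy.le]
      rw [h0.fderiv_eq]
      simp
  -- Γ equals φ where s = 1 and is affine far from q. In between it differs from an affine
  -- isomorphism by the small Lipschitz term w, which makes it globally bijective.
  let Γ : E → E := fun x => φ q + A (x - q) + w x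
  have hΓ : ContDiff ℝ ∞ Γ :=
    (contDiff_const.add (A.contDiff.comp (contDiff_id.sub contDiff_const))).add hw
  let c : NNReal := 1 / (2 * N)
  have hc : (c : ℝ) = 1 / (2 * N) := by simp [c]
  have hwl : LipschitzWith c w := lipschitzWith_of_nnnorm_fderiv_le
    (hw.differentiable (by simp)) fun x => by
      rw [← NNReal.coe_le_coe, hc]
      exact hwd x
  have hΓeq : ∀ x y, Γ x - Γ y = A (x - y) + (w x - w y) := by
    intro x y
    simp only [Γ, map_sub]
    abel
  have happ : ApproximatesLinearOn Γ (A : E →L[ℝ] E) univ c := by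
    intro x _ y _
    rw [hΓeq]
    simpa [← dist_eq_norm] using hwl.dist_le_mul x y
  obtain ⟨Φ, hΦ⟩ := exists_diffeomorph_of_bijective hΓ
    ⟨injOn_univ.1 (happ.injOn hNc), happ.surjective hNc⟩ fun x => by
      have h1 : HasFDerivAt Γ (fderiv ℝ Γ x) x := (hΓ.differentiable (by simp) x).hasFDerivAt
      have h2 : fderiv ℝ Γ x = A + fderiv ℝ w x := by
        have h3 := HasFDerivAt.comp (f := fun x => x - q) x
          ((A : E →L[ℝ] E).hasFDerivAt (x := x - q)) ((hasFDerivAt_id x).sub_const q)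
        rw [ContinuousLinearMap.comp_id] at h3
        exact ((h3.const_add (φ q)).add (hw.differentiable (by simp) x).hasFDerivAt).fderiv
      obtain ⟨B, hB⟩ := exists_continuousLinearEquiv_of_injective (fderiv ℝ Γ x) <| by
        rw [injective_iff_map_eq_zero]
        intro v hv
        rw [h2, add_apply, ContinuousLinearEquiv.coe_coe,
          add_eq_zero_iff_eq_neg] at hv
        have h4 := hN v
        have h5 := ((fderiv ℝ w x).le_of_opNorm_le (hwd x)) v
        rw [hv, norm_neg] at h4
        have h6 : N * ‖fderiv ℝ w x v‖ ≤ N * (1 / (2 * N) * ‖v‖) := by gcongr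
        have h7 : N * (1 / (2 * N) * ‖v‖) = ‖v‖ / 2 := by field_simp
        rw [← norm_eq_zero]
        linarith [norm_nonneg v]
      exact ⟨B, hB ▸ h1⟩
  refine ⟨Φ, ?_⟩
  rw [hΦ]
  filter_upwards [Metric.closedBall_mem_nhds q hδ] with x hx
  rw [mem_closedBall_iff_norm] at hx
  simp [Γ, w, r, hs1 x hx]

/-! ### Parametrized planes and gluing -/

/-- The inclusion of the `x₁x₂`-plane. -/
def inclPlane (z : ℝ × ℝ) : R4 := (z.1, z.2, 0, 0)

/-- The projection to the `x₁x₂`-plane. -/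
def projPlane (p : R4) : ℝ × ℝ := (p.1, p.2.1)

theorem contDiff_inclPlane : ContDiff ℝ ∞ inclPlane := by
  unfold inclPlane
  fun_prop

theorem contDiff_projPlane : ContDiff ℝ ∞ projPlane := by
  unfold projPlane
  fun_prop

theorem inclPlane_projPlane {p : R4} (hp : p ∈ L0) : inclPlane (projPlane p) = p := by
  obtain ⟨x₁, x₂, y₁, y₂⟩ := p
  obtain ⟨h1, h2⟩ := hp
  simp only at h1 h2
  simp [inclPlane, projPlane, h1, h2]

theorem projPlane_inclPlane (z : ℝ × ℝ) : projPlane (inclPlane z) = z := rfl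

theorem inclPlane_mem (z : ℝ × ℝ) : inclPlane z ∈ L0 := ⟨rfl, rfl⟩

/-- `f` is a smooth embedding of the plane with image `L`. -/
def IsPlaneParam (f : ℝ × ℝ → R4) (L : Set R4) : Prop :=
  ContDiff ℝ ∞ f ∧ (∀ q, Function.Injective (fderiv ℝ f q)) ∧ IsEmbedding f ∧ range f = L

theorem diffeomorph_fderiv_injective {E : Type*} [NormedAddCommGroup E] [NormedSpace ℝ E]
    (Φ : E ≃ₘ[ℝ] E) (x : E) : Function.Injective (fderiv ℝ Φ x) := by
  have h1 := (Φ.contDiff.differentiable (by simp) x).hasFDerivAt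
  have h2 := (Φ.symm.contDiff.differentiable (by simp) (Φ x)).hasFDerivAt
  have h3 := h2.comp x h1
  have h4 : (⇑Φ.symm ∘ ⇑Φ) = id := funext fun q => Φ.symm_apply_apply q
  rw [h4] at h3
  have h5 := h3.unique (hasFDerivAt_id x)
  refine Function.LeftInverse.injective (g := fderiv ℝ Φ.symm (Φ x)) fun v => ?_
  exact congrArg (fun A : E →L[ℝ] E => A v) h5

theorem IsPlaneParam.comp {f : ℝ × ℝ → R4} {L : Set R4} (hf : IsPlaneParam f L)
    (Φ : (ℝ × ℝ) ≃ₘ[ℝ] (ℝ × ℝ)) : IsPlaneParam (f ∘ Φ) L := by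
  refine ⟨hf.1.comp Φ.contDiff, fun q => ?_, hf.2.2.1.comp Φ.toHomeomorph.isEmbedding, ?_⟩
  · rw [fderiv_comp q (hf.1.differentiable (by simp) _) (Φ.contDiff.differentiable (by simp) _)]
    exact (hf.2.1 _).comp (diffeomorph_fderiv_injective Φ q)
  · rw [range_comp, show range Φ = univ from Φ.surjective.range_eq, image_univ, hf.2.2.2]

theorem IsEmbeddedPlane.image {L : Set R4} (hL : IsEmbeddedPlane L) (Φ : R4 ≃ₘ[ℝ] R4) :
    IsEmbeddedPlane (Φ '' L) := by
  obtain ⟨f, hf, hd, he, rfl⟩ := hL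
  refine ⟨Φ ∘ f, Φ.contDiff.comp hf, fun q => ?_, Φ.toHomeomorph.isEmbedding.comp he, ?_⟩
  · rw [fderiv_comp q (Φ.contDiff.differentiable (by simp) _) (hf.differentiable (by simp) _)]
    exact (diffeomorph_fderiv_injective Φ _).comp (hd q)
  · rw [range_comp]

/-- An embedded plane that is flat on `{x₁ > 0}` has a parametrization that is the standard one
near a given point of this region. -/
theorem exists_planeParam_standard {L : Set R4} (hL : IsEmbeddedPlane L)
    (hflat : ∀ p : R4, 0 < p.1 → (p ∈ L ↔ p ∈ L0)) {c : ℝ × ℝ} (hc : 0 < c.1) :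
    ∃ E : ℝ × ℝ → R4, IsPlaneParam E L ∧ ∀ᶠ z in 𝓝 c, E z = inclPlane z := by
  obtain ⟨f, hf : IsPlaneParam f L⟩ := hL
  have hcL : inclPlane c ∈ range f := by
    rw [hf.2.2.2, hflat _ hc]
    exact inclPlane_mem c
  obtain ⟨q, hq⟩ := hcL
  let φ : ℝ × ℝ → ℝ × ℝ := projPlane ∘ f
  have hφ : ContDiff ℝ ∞ φ := contDiff_projPlane.comp hf.1
  have hev : f =ᶠ[𝓝 q] inclPlane ∘ φ := by
    have h1 : ∀ᶠ x in 𝓝 q, 0 < (f x).1 := by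
      apply continuousAt_const.eventually_lt hf.1.continuous.fst.continuousAt
      rw [hq]
      exact hc
    filter_upwards [h1] with x hx
    refine (inclPlane_projPlane ?_).symm
    rw [← hflat _ hx, ← hf.2.2.2]
    exact mem_range_self x
  have hφd : DifferentiableAt ℝ φ q := hφ.differentiable (by simp) q
  have hinj : Function.Injective (fderiv ℝ φ q) := by
    have h1 := hf.2.1 q
    rw [hev.fderiv_eq, fderiv_comp q (contDiff_inclPlane.differentiable (by simp) _) hφd] at h1
    exact fun x y hxy => h1 (congrArg (fderiv ℝ inclPlane _) hxy)
  obtain ⟨A, hA⟩ := exists_continuousLinearEquiv_of_injective _ hinj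
  obtain ⟨Γ, hΓ⟩ := exists_diffeomorph_eventuallyEq hφ A (hA ▸ hφd.hasFDerivAt)
  refine ⟨f ∘ Γ.symm, hf.comp Γ.symm, ?_⟩
  have hφq : φ q = c := by
    simp only [φ, Function.comp_apply, hq, projPlane_inclPlane]
  have hΓc : Γ.symm c = q := by
    rw [← hφq, ← hΓ.eq_of_nhds, Γ.symm_apply_apply]
  have h2 : Filter.Tendsto Γ.symm (𝓝 c) (𝓝 q) := by
    have := Γ.symm.contDiff.continuous.continuousAt (x := c)
    rwa [ContinuousAt, hΓc] at this
  filter_upwards [h2.eventually hev, h2.eventually hΓ] with z hz1 hz2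
  rw [Function.comp_apply, hz1, Function.comp_apply, ← hz2, Γ.apply_symm_apply]

/-- Replacing a piece of a flat region of an embedded plane by a piece of another embedded plane
yields an embedded plane, if the first one is parametrized in the standard way over the flat
region `U`. -/
theorem IsPlaneParam.glue {L L' M K : Set R4} {U : Set (ℝ × ℝ)} {E f : ℝ × ℝ → R4}
    (hE : IsPlaneParam E L) (hf : IsPlaneParam f L') (hU : IsOpen U)
    (hEU : ∀ z ∈ U, E z = inclPlane z) (hLU : ∀ p, projPlane p ∈ U → (p ∈ L ↔ p ∈ L0))
    (hK : IsClosed K) (hKU : ∀ p ∈ K, projPlane p ∈ U) (hL'K : AgreesOutside L' K)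
    (hMU : ∀ p, projPlane p ∈ U → (p ∈ M ↔ p ∈ L')) (hMK : ∀ p ∉ K, (p ∈ M ↔ p ∈ L)) :
    IsEmbeddedPlane M := by
  classical
  have hfM : ∀ q, f q ∈ L' := fun q => hf.2.2.2 ▸ mem_range_self q
  have hEL : ∀ q, E q ∈ L := fun q => hE.2.2.2 ▸ mem_range_self q
  have hflat : ∀ p, p ∉ K → (p ∈ L' ↔ p ∈ L0) := fun p hp =>
    ⟨fun h => ((hL'K.subset ⟨h, hp⟩) : p ∈ L0 \ K).1, fun h => (hL'K.superset ⟨h, hp⟩).1⟩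
  -- Where f is off K it takes values in `L0`, and E carries their plane coordinates to L. Over U
  -- the map E is standard, so f and g agree there off K; hence F is smooth, running through L' over
  -- U and through L elsewhere.
  let g : ℝ × ℝ → R4 := fun q => E (projPlane (f q))
  let F : ℝ × ℝ → R4 := fun q => if projPlane (f q) ∈ U then f q else g q
  have hF1 : ∀ q, projPlane (f q) ∈ U → F q = f q := fun q hq => if_pos hq
  have hF2 : ∀ q, f q ∉ K → F q = g q := by
    intro q hq
    by_cases h : projPlane (f q) ∈ U
    · rw [hF1 q h]
      simp only [g]
      rw [hEU _ h, inclPlane_projPlane ((hflat _ hq).1 (hfM q))]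
    · exact if_neg h
  have hcov : ∀ q, projPlane (f q) ∈ U ∨ f q ∉ K := fun q =>
    or_iff_not_imp_right.2 fun h => hKU _ (not_not.1 h)
  have hev1 : ∀ q, projPlane (f q) ∈ U → F =ᶠ[𝓝 q] f := fun q hq => by
    filter_upwards [(hU.preimage (contDiff_projPlane.continuous.comp hf.1.continuous)).mem_nhds hq]
      with x hx using hF1 x hx
  have hev2 : ∀ q, f q ∉ K → F =ᶠ[𝓝 q] g := fun q hq => by
    filter_upwards [(hK.isOpen_compl.preimage hf.1.continuous).mem_nhds hq] with x hx using hF2 x hx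
  have hgc : ContDiff ℝ ∞ g := hE.1.comp (contDiff_projPlane.comp hf.1)
  -- points of the image of `E` over `U`
  have hEmem : ∀ z, projPlane (E z) ∈ U → z = projPlane (E z) := by
    intro z hz
    apply hE.2.2.1.injective
    rw [hEU _ hz, inclPlane_projPlane ((hLU _ hz).1 (hEL z))]
  have hEK : ∀ z, inclPlane z ∉ K → E z ∉ K := by
    intro z hz h
    have h1 := hEmem z (hKU _ h)
    rw [h1, inclPlane_projPlane ((hLU _ (hKU _ h)).1 (hEL z))] at hz
    exact hz h
  have hpre1 : ∀ q, projPlane (F q) ∈ U → projPlane (f q) ∈ U := by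
    intro q hq
    by_contra h
    have h1 : F q = g q := if_neg h
    rw [h1] at hq
    exact h (by rw [hEmem _ hq]; exact hq)
  have hpre2 : ∀ q, f q ∉ K → F q ∉ K := by
    intro q hq
    rw [hF2 q hq]
    apply hEK
    rwa [inclPlane_projPlane ((hflat _ hq).1 (hfM q))]
  have hpre3 : ∀ q, F q ∉ K → f q ∉ K := by
    intro q hq h
    rw [hF1 q (hKU _ h)] at hq
    exact hq h
  have hinj : Function.Injective F := by
    intro q₁ q₂ h
    by_cases h1 : F q₁ ∈ K
    · have h2 : F q₂ ∈ K := h ▸ h1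
      rw [hF1 _ (hpre1 _ (hKU _ h1)), hF1 _ (hpre1 _ (hKU _ h2))] at h
      exact hf.2.2.1.injective h
    · have h2 : F q₂ ∉ K := h ▸ h1
      have h3 := hpre3 _ h1
      have h4 := hpre3 _ h2
      rw [hF2 _ h3, hF2 _ h4] at h
      have h5 := hE.2.2.1.injective h
      apply hf.2.2.1.injective
      rw [← inclPlane_projPlane ((hflat _ h3).1 (hfM _)), h5,
        inclPlane_projPlane ((hflat _ h4).1 (hfM _))]
  have hcF : ContDiff ℝ ∞ F := by
    rw [contDiff_iff_contDiffAt]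
    intro q
    rcases hcov q with h | h
    · exact hf.1.contDiffAt.congr_of_eventuallyEq (hev1 q h)
    · exact hgc.contDiffAt.congr_of_eventuallyEq (hev2 q h)
  have hfg : ∀ q, f q ∉ K → f =ᶠ[𝓝 q] inclPlane ∘ (projPlane ∘ f) := fun q hq => by
    filter_upwards [(hK.isOpen_compl.preimage hf.1.continuous).mem_nhds hq] with x hx
    exact (inclPlane_projPlane ((hflat _ hx).1 (hfM x))).symm
  refine ⟨F, hcF, fun q => ?_, ⟨?_, hinj⟩, ?_⟩
  · rcases hcov q with h | h
    · rw [(hev1 q h).fderiv_eq]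
      exact hf.2.1 q
    · have hd : DifferentiableAt ℝ (projPlane ∘ f) q :=
        (contDiff_projPlane.comp hf.1).differentiable (by simp) q
      rw [(hev2 q h).fderiv_eq, show g = E ∘ (projPlane ∘ f) from rfl,
        fderiv_comp q (hE.1.differentiable (by simp) _) hd]
      refine (hE.2.1 _).comp ?_
      have h1 := hf.2.1 q
      rw [(hfg q h).fderiv_eq,
        fderiv_comp q (contDiff_inclPlane.differentiable (by simp) _) hd] at h1
      exact fun x y hxy => h1 (congrArg (fderiv ℝ inclPlane _) hxy)
  · rw [isInducing_iff_nhds]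
    intro q
    -- For the reverse inequality, a neighbourhood of F q is shrunk to the part over U, or to the
    -- part off K. By `hpre1` and `hpre3`, its preimage consists of points where F is given by f, or
    -- by g.
    refine le_antisymm (hcF.continuous.continuousAt.le_comap) ?_
    rcases hcov q with h | h
    · rw [hf.2.2.1.isInducing.nhds_eq_comap q, hF1 q h]
      intro s hs
      rw [Filter.mem_comap] at hs ⊢
      obtain ⟨t, ht, hts⟩ := hs
      refine ⟨t ∩ projPlane ⁻¹' U,
        Filter.inter_mem ht ((hU.preimage contDiff_projPlane.continuous).mem_nhds h), ?_⟩
      rintro x ⟨hx1, hx2⟩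
      apply hts
      rw [hF1 x (hpre1 x hx2)] at hx1
      exact hx1
    · rw [hf.2.2.1.isInducing.nhds_eq_comap q, hF2 q h]
      intro s hs
      rw [Filter.mem_comap] at hs
      obtain ⟨t, ht, hts⟩ := hs
      have h1 : inclPlane ⁻¹' t ∈ 𝓝 (projPlane (f q)) := by
        apply contDiff_inclPlane.continuous.continuousAt
        rwa [inclPlane_projPlane ((hflat _ h).1 (hfM q))]
      rw [hE.2.2.1.isInducing.nhds_eq_comap, Filter.mem_comap] at h1
      obtain ⟨u, hu, hut⟩ := h1
      rw [Filter.mem_comap]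
      have h2 : g q ∉ K := hF2 q h ▸ hpre2 q h
      refine ⟨u ∩ Kᶜ, Filter.inter_mem hu (hK.isOpen_compl.mem_nhds h2), ?_⟩
      rintro x ⟨hx1, hx2⟩
      have h3 := hpre3 x hx2
      rw [hF2 x h3] at hx1
      apply hts
      have h4 := hut hx1
      rwa [mem_preimage, inclPlane_projPlane ((hflat _ h3).1 (hfM x))] at h4
  · ext p
    constructor
    · rintro ⟨q, rfl⟩
      rcases hcov q with h | h
      · rw [hF1 q h, hMU _ h]
        exact hfM q
      · rw [hMK _ (hpre2 q h), hF2 q h]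
        exact hEL _
    · intro hp
      by_cases h : p ∈ K
      · have h1 := hKU _ h
        rw [hMU _ h1, ← hf.2.2.2] at hp
        obtain ⟨q, rfl⟩ := hp
        exact ⟨q, hF1 q h1⟩
      · rw [hMK _ h, ← hE.2.2.2] at hp
        obtain ⟨z, rfl⟩ := hp
        have h1 : inclPlane z ∉ K := by
          intro h1
          have h2 : z ∈ U := hKU _ h1
          rw [hEU z h2] at h
          exact h h1
        have h2 : inclPlane z ∈ L' := (hflat _ h1).2 (inclPlane_mem z)
        rw [← hf.2.2.2] at h2
        obtain ⟨q, hq⟩ := h2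
        refine ⟨q, ?_⟩
        rw [hF2 q (by rwa [hq])]
        simp only [g]
        rw [hq, projPlane_inclPlane]

/-! ### Area-preserving maps of the plane and symplectic maps of four-space -/

/-- The area form of the plane. -/
def area (u v : ℝ × ℝ) : ℝ := u.1 * v.2 - u.2 * v.1

theorem area_map (A : ℝ × ℝ →L[ℝ] ℝ × ℝ) (u v : ℝ × ℝ) :
    area (A u) (A v) = A.det * area u v := by
  have h : ∀ w : ℝ × ℝ, A w = w.1 • A (1, 0) + w.2 • A (0, 1) := by
    intro w
    rw [← map_smul, ← map_smul, ← map_add]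
    simp
  rw [continuousLinearMap_det_prod, h u, h v]
  simp only [area, Prod.fst_add, Prod.snd_add, Prod.smul_fst, Prod.smul_snd, smul_eq_mul]
  ring

theorem fderiv_det_trans {φ χ : (ℝ × ℝ) ≃ₘ[ℝ] (ℝ × ℝ)} (hφ : ∀ p, (fderiv ℝ φ p).det = 1)
    (hχ : ∀ p, (fderiv ℝ χ p).det = 1) (p : ℝ × ℝ) : (fderiv ℝ (φ.trans χ) p).det = 1 := by
  have h1 : DifferentiableAt ℝ φ p := φ.contDiff.differentiable (by simp) p
  have h2 : DifferentiableAt ℝ χ (φ p) := χ.contDiff.differentiable (by simp) (φ p)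
  have e1 := hφ p
  have e2 := hχ (φ p)
  rw [ContinuousLinearMap.det] at e1 e2
  rw [Diffeomorph.coe_trans, fderiv_comp p h2 h1, ContinuousLinearMap.det,
    ContinuousLinearMap.toLinearMap_comp, LinearMap.det_comp, e1, e2, one_mul]

theorem fderiv_det_symm {φ : (ℝ × ℝ) ≃ₘ[ℝ] (ℝ × ℝ)} (hφ : ∀ p, (fderiv ℝ φ p).det = 1)
    (p : ℝ × ℝ) : (fderiv ℝ φ.symm p).det = 1 := by
  have h1 := (φ.symm.contDiff.differentiable (by simp) p).hasFDerivAt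
  have h2 := (φ.contDiff.differentiable (by simp) (φ.symm p)).hasFDerivAt
  have h3 := h2.comp p h1
  have h4 : (⇑φ ∘ ⇑φ.symm) = id := funext fun q => φ.apply_symm_apply q
  rw [h4] at h3
  have h5 := congrArg (fun A : ℝ × ℝ →L[ℝ] ℝ × ℝ => LinearMap.det (A : ℝ × ℝ →ₗ[ℝ] ℝ × ℝ))
    (h3.unique (hasFDerivAt_id p))
  have e1 := hφ (φ.symm p)
  rw [ContinuousLinearMap.det] at e1
  simp only [ContinuousLinearMap.toLinearMap_comp, LinearMap.det_comp] at h5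
  rw [e1, one_mul] at h5
  exact h5.trans LinearMap.det_id

theorem contDiff_deriv {f : ℝ → ℝ} (hf : ContDiff ℝ ∞ f) : ContDiff ℝ ∞ (deriv f) :=
  ((contDiff_infty_iff_deriv (𝕜 := ℝ)).1 hf).2

/-- The lift of an increasing diffeomorphism of the line to an area-preserving diffeomorphism of
its cotangent bundle. -/
noncomputable def liftPlane (h : ℝ ≃ₘ[ℝ] ℝ) (hd : ∀ x, 0 < deriv h x) :
    (ℝ × ℝ) ≃ₘ[ℝ] (ℝ × ℝ) where
  toFun z := (h z.1, z.2 / deriv h z.1)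
  invFun z := (h.symm z.1, z.2 * deriv h (h.symm z.1))
  left_inv z := by
    have := (hd z.1).ne'
    ext <;> simp [this]
  right_inv z := by
    have := (hd (h.symm z.1)).ne'
    ext <;> simp [this]
  contMDiff_toFun := by
    have h1 : ContDiff ℝ ∞ h := h.contDiff
    have h2 := contDiff_deriv h1
    refine ContDiff.contMDiff ?_
    exact (h1.comp contDiff_fst).prodMk
      (contDiff_snd.div (h2.comp contDiff_fst) fun z => (hd _).ne')
  contMDiff_invFun := by
    have h1 : ContDiff ℝ ∞ h.symm := h.symm.contDiff
    have h2 := contDiff_deriv h.contDiff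
    refine ContDiff.contMDiff ?_
    exact (h1.comp contDiff_fst).prodMk
      (contDiff_snd.mul (h2.comp (h1.comp contDiff_fst)))

theorem liftPlane_apply (h : ℝ ≃ₘ[ℝ] ℝ) (hd : ∀ x, 0 < deriv h x) (z : ℝ × ℝ) :
    liftPlane h hd z = (h z.1, z.2 / deriv h z.1) := rfl

theorem liftPlane_fderiv_det (h : ℝ ≃ₘ[ℝ] ℝ) (hd : ∀ x, 0 < deriv h x) (z : ℝ × ℝ) :
    (fderiv ℝ (liftPlane h hd) z).det = 1 := by
  have h0 := hd z.1
  have h1 : HasDerivAt h (deriv h z.1) z.1 := (h.contDiff.differentiable (by simp) _).hasDerivAt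
  have h2 : HasDerivAt (deriv h) (deriv (deriv h) z.1) z.1 :=
    ((contDiff_deriv h.contDiff).differentiable (by simp) _).hasDerivAt
  have hf : HasFDerivAt Prod.fst (ContinuousLinearMap.fst ℝ ℝ ℝ) z := hasFDerivAt_fst
  have h3 : HasFDerivAt (fun z : ℝ × ℝ => h z.1) _ z := h1.comp_hasFDerivAt z hf
  have h4 : HasFDerivAt (fun z : ℝ × ℝ => (deriv h z.1)⁻¹) _ z :=
    (h2.inv h0.ne').comp_hasFDerivAt z hf
  have h5 := h3.prodMk ((hasFDerivAt_snd (𝕜 := ℝ) (p := z)).mul h4)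
  have h6 : fderiv ℝ (liftPlane h hd) z = _ := h5.fderiv
  rw [h6, continuousLinearMap_det_prod]
  simp
  field_simp

/-- The fibre coordinate is divided by h', so h has to be the identity near the base point and not
only at it; hence the open set. -/
theorem liftPlane_eq_self (h : ℝ ≃ₘ[ℝ] ℝ) (hd : ∀ x, 0 < deriv h x) {s : Set ℝ} (hs : IsOpen s)
    (hh : ∀ x ∈ s, h x = x) {z : ℝ × ℝ} (hz : z.1 ∈ s) : liftPlane h hd z = z := by
  have h1 : h =ᶠ[𝓝 z.1] id := by
    filter_upwards [hs.mem_nhds hz] with x hx using hh x hx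
  rw [liftPlane_apply, h1.deriv_eq, hh _ hz]
  simp

/-- A diffeomorphism of the `x₁y₁`-plane, extended to four-space. -/
noncomputable def extendOne (φ : (ℝ × ℝ) ≃ₘ[ℝ] (ℝ × ℝ)) : R4 ≃ₘ[ℝ] R4 where
  toFun p := ((φ (p.1, p.2.2.1)).1, p.2.1, (φ (p.1, p.2.2.1)).2, p.2.2.2)
  invFun p := ((φ.symm (p.1, p.2.2.1)).1, p.2.1, (φ.symm (p.1, p.2.2.1)).2, p.2.2.2)
  left_inv p := by simp
  right_inv p := by simp
  contMDiff_toFun := by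
    refine ContDiff.contMDiff ?_
    have h1 : ContDiff ℝ ∞ φ := φ.contDiff
    have h2 : ContDiff ℝ ∞ fun p : R4 => φ (p.1, p.2.2.1) := h1.comp (by fun_prop)
    exact h2.fst.prodMk (ContDiff.prodMk (by fun_prop) (h2.snd.prodMk (by fun_prop)))
  contMDiff_invFun := by
    refine ContDiff.contMDiff ?_
    have h1 : ContDiff ℝ ∞ φ.symm := φ.symm.contDiff
    have h2 : ContDiff ℝ ∞ fun p : R4 => φ.symm (p.1, p.2.2.1) := h1.comp (by fun_prop)
    exact h2.fst.prodMk (ContDiff.prodMk (by fun_prop) (h2.snd.prodMk (by fun_prop)))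

theorem extendOne_apply (φ : (ℝ × ℝ) ≃ₘ[ℝ] (ℝ × ℝ)) (p : R4) :
    extendOne φ p = ((φ (p.1, p.2.2.1)).1, p.2.1, (φ (p.1, p.2.2.1)).2, p.2.2.2) := rfl

/-- A diffeomorphism of the plane, extended to four-space by letting it act on the coordinates
`(y₂, x₂)`. -/
noncomputable def extendTwo (φ : (ℝ × ℝ) ≃ₘ[ℝ] (ℝ × ℝ)) : R4 ≃ₘ[ℝ] R4 where
  toFun p := (p.1, (φ (p.2.2.2, p.2.1)).2, p.2.2.1, (φ (p.2.2.2, p.2.1)).1)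
  invFun p := (p.1, (φ.symm (p.2.2.2, p.2.1)).2, p.2.2.1, (φ.symm (p.2.2.2, p.2.1)).1)
  left_inv p := by simp
  right_inv p := by simp
  contMDiff_toFun := by
    refine ContDiff.contMDiff ?_
    have h1 : ContDiff ℝ ∞ φ := φ.contDiff
    have h2 : ContDiff ℝ ∞ fun p : R4 => φ (p.2.2.2, p.2.1) := h1.comp (by fun_prop)
    exact ContDiff.prodMk (by fun_prop) (h2.snd.prodMk (ContDiff.prodMk (by fun_prop) h2.fst))
  contMDiff_invFun := by
    refine ContDiff.contMDiff ?_
    have h1 : ContDiff ℝ ∞ φ.symm := φ.symm.contDiff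
    have h2 : ContDiff ℝ ∞ fun p : R4 => φ.symm (p.2.2.2, p.2.1) := h1.comp (by fun_prop)
    exact ContDiff.prodMk (by fun_prop) (h2.snd.prodMk (ContDiff.prodMk (by fun_prop) h2.fst))

theorem extendTwo_apply (φ : (ℝ × ℝ) ≃ₘ[ℝ] (ℝ × ℝ)) (p : R4) :
    extendTwo φ p = (p.1, (φ (p.2.2.2, p.2.1)).2, p.2.2.1, (φ (p.2.2.2, p.2.1)).1) := rfl

/-- A diffeomorphism of four-space that preserves the symplectic form. -/
def IsSymplectic (Θ : R4 ≃ₘ[ℝ] R4) : Prop :=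
  ∀ p u v, omega (fderiv ℝ Θ p u) (fderiv ℝ Θ p v) = omega u v

theorem fderiv_extendOne (φ : (ℝ × ℝ) ≃ₘ[ℝ] (ℝ × ℝ)) (p u : R4) :
    fderiv ℝ (extendOne φ) p u =
      ((fderiv ℝ φ (p.1, p.2.2.1) (u.1, u.2.2.1)).1, u.2.1,
        (fderiv ℝ φ (p.1, p.2.2.1) (u.1, u.2.2.1)).2, u.2.2.2) := by
  let A : R4 →L[ℝ] ℝ × ℝ := (ContinuousLinearMap.fst ℝ ℝ _).prod
    (ContinuousLinearMap.fst ℝ ℝ _ ∘L ContinuousLinearMap.snd ℝ ℝ _ ∘L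
      ContinuousLinearMap.snd ℝ ℝ _)
  let B : R4 →L[ℝ] ℝ := ContinuousLinearMap.fst ℝ ℝ _ ∘L ContinuousLinearMap.snd ℝ ℝ _
  let C : R4 →L[ℝ] ℝ := ContinuousLinearMap.snd ℝ ℝ _ ∘L ContinuousLinearMap.snd ℝ ℝ _ ∘L
      ContinuousLinearMap.snd ℝ ℝ _
  have h1 : HasFDerivAt φ (fderiv ℝ φ (A p)) (A p) :=
    (φ.contDiff.differentiable (by simp) _).hasFDerivAt
  have h2 := h1.comp p A.hasFDerivAt
  have h3 := h2.fst.prodMk (B.hasFDerivAt.prodMk (h2.snd.prodMk C.hasFDerivAt))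
  have h4 : fderiv ℝ (extendOne φ) p = _ := h3.fderiv
  rw [h4]
  rfl

theorem fderiv_extendTwo (φ : (ℝ × ℝ) ≃ₘ[ℝ] (ℝ × ℝ)) (p u : R4) :
    fderiv ℝ (extendTwo φ) p u =
      (u.1, (fderiv ℝ φ (p.2.2.2, p.2.1) (u.2.2.2, u.2.1)).2, u.2.2.1,
        (fderiv ℝ φ (p.2.2.2, p.2.1) (u.2.2.2, u.2.1)).1) := by
  let A : R4 →L[ℝ] ℝ × ℝ := (ContinuousLinearMap.snd ℝ ℝ _ ∘L ContinuousLinearMap.snd ℝ ℝ _ ∘L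
      ContinuousLinearMap.snd ℝ ℝ _).prod
    (ContinuousLinearMap.fst ℝ ℝ _ ∘L ContinuousLinearMap.snd ℝ ℝ _)
  let B : R4 →L[ℝ] ℝ := ContinuousLinearMap.fst ℝ ℝ _
  let C : R4 →L[ℝ] ℝ := ContinuousLinearMap.fst ℝ ℝ _ ∘L ContinuousLinearMap.snd ℝ ℝ _ ∘L
      ContinuousLinearMap.snd ℝ ℝ _
  have h1 : HasFDerivAt φ (fderiv ℝ φ (A p)) (A p) :=
    (φ.contDiff.differentiable (by simp) _).hasFDerivAt
  have h2 := h1.comp p A.hasFDerivAt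
  have h3 := B.hasFDerivAt.prodMk (h2.snd.prodMk (C.hasFDerivAt.prodMk h2.fst))
  have h4 : fderiv ℝ (extendTwo φ) p = _ := h3.fderiv
  rw [h4]
  rfl

theorem isSymplectic_extendOne {φ : (ℝ × ℝ) ≃ₘ[ℝ] (ℝ × ℝ)} (hφ : ∀ p, (fderiv ℝ φ p).det = 1) :
    IsSymplectic (extendOne φ) := by
  intro p u v
  rw [fderiv_extendOne, fderiv_extendOne]
  have h := area_map (fderiv ℝ φ (p.1, p.2.2.1)) (u.1, u.2.2.1) (v.1, v.2.2.1)
  rw [hφ, one_mul] at h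
  simp only [area] at h
  simp only [omega]
  linarith

/-- The order (y₂, x₂) makes y₂ the base coordinate of a lift. It changes the area form only by a
sign, which does not affect its invariance. -/
theorem isSymplectic_extendTwo {φ : (ℝ × ℝ) ≃ₘ[ℝ] (ℝ × ℝ)} (hφ : ∀ p, (fderiv ℝ φ p).det = 1) :
    IsSymplectic (extendTwo φ) := by
  intro p u v
  rw [fderiv_extendTwo, fderiv_extendTwo]
  have h := area_map (fderiv ℝ φ (p.2.2.2, p.2.1)) (u.2.2.2, u.2.1) (v.2.2.2, v.2.1)
  rw [hφ, one_mul] at h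
  simp only [area] at h
  simp only [omega]
  linarith

/-- The translation in the `x₁`-direction as a diffeomorphism. -/
def translateDiffeo (t : ℝ) : R4 ≃ₘ[ℝ] R4 where
  toFun := translateX1 t
  invFun := translateX1 (-t)
  left_inv p := by simp [translateX1]
  right_inv p := by simp [translateX1]
  contMDiff_toFun := by
    refine ContDiff.contMDiff ?_
    change ContDiff ℝ ∞ fun p : R4 => (p.1 + t, p.2.1, p.2.2.1, p.2.2.2)
    fun_prop
  contMDiff_invFun := by
    refine ContDiff.contMDiff ?_
    change ContDiff ℝ ∞ fun p : R4 => (p.1 + -t, p.2.1, p.2.2.1, p.2.2.2)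
    fun_prop

theorem translateDiffeo_apply (t : ℝ) (p : R4) : translateDiffeo t p = translateX1 t p := rfl

theorem fderiv_translateDiffeo (t : ℝ) (p u : R4) : fderiv ℝ (translateDiffeo t) p u = u := by
  have h : ⇑(translateDiffeo t) = fun p => p + ((t, 0, 0, 0) : R4) := by
    funext p
    simp [translateDiffeo_apply, translateX1, Prod.ext_iff]
  rw [h, fderiv_add_const]
  simp

theorem isSymplectic_translateDiffeo (t : ℝ) : IsSymplectic (translateDiffeo t) := by
  intro p u v
  rw [fderiv_translateDiffeo, fderiv_translateDiffeo]

/-! ### Images of Lagrangians, transversality and levels -/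

theorem IsTangent.image {L : Set R4} {p v : R4} (h : IsTangent L p v) (Θ : R4 ≃ₘ[ℝ] R4) :
    IsTangent (Θ '' L) (Θ p) (fderiv ℝ Θ p v) := by
  obtain ⟨c, hc, rfl, hcL, rfl⟩ := h
  refine ⟨Θ ∘ c, Θ.contDiff.comp hc, rfl, hcL.mono fun t ht => mem_image_of_mem _ ht, ?_⟩
  exact ((Θ.contDiff.differentiable (by simp) _).hasFDerivAt.comp_hasDerivAt 0
    (hc.differentiable (by simp) 0).hasDerivAt).deriv

theorem image_symm_image (Θ : R4 ≃ₘ[ℝ] R4) (L : Set R4) : Θ.symm '' (Θ '' L) = L := by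
  rw [image_image]
  simp

theorem IsTangent.exists_of_image {L : Set R4} {p v : R4} {Θ : R4 ≃ₘ[ℝ] R4}
    (h : IsTangent (Θ '' L) (Θ p) v) : ∃ u, IsTangent L p u ∧ fderiv ℝ Θ p u = v := by
  have h1 := h.image Θ.symm
  rw [image_symm_image, Θ.symm_apply_apply] at h1
  refine ⟨_, h1, ?_⟩
  have h2 := (Θ.contDiff.differentiable (by simp) p).hasFDerivAt
  rw [← Θ.symm_apply_apply p] at h2
  have h3 := h2.comp (Θ p) (Θ.symm.contDiff.differentiable (by simp) (Θ p)).hasFDerivAt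
  have h4 : (⇑Θ ∘ ⇑Θ.symm) = id := funext fun q => Θ.apply_symm_apply q
  rw [h4] at h3
  have h5 := h3.unique (hasFDerivAt_id _)
  rw [Θ.symm_apply_apply] at h5
  exact congrArg (fun A : R4 →L[ℝ] R4 => A v) h5

theorem AgreesOutside.image {L K : Set R4} (h : AgreesOutside L K) {Θ : R4 ≃ₘ[ℝ] R4}
    (h0 : Θ '' L0 = L0) : AgreesOutside (Θ '' L) (Θ '' K) := by
  unfold AgreesOutside at *
  have hi : Function.Injective Θ := Θ.injective
  rw [← image_sdiff hi, h, image_sdiff hi, h0]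

theorem IsPlanarLagrangian.image {L : Set R4} (h : IsPlanarLagrangian L) {Θ : R4 ≃ₘ[ℝ] R4}
    (hΘ : IsSymplectic Θ) : IsPlanarLagrangian (Θ '' L) := by
  refine ⟨h.1.image Θ, ?_⟩
  rintro _ ⟨p, hp, rfl⟩ u v hu hv
  obtain ⟨u, hu', rfl⟩ := hu.exists_of_image
  obtain ⟨v, hv', rfl⟩ := hv.exists_of_image
  rw [hΘ]
  exact h.2 p hp u v hu' hv'

theorem IsFlatPlanarLagrangian.image {L : Set R4} (h : IsFlatPlanarLagrangian L)
    {Θ : R4 ≃ₘ[ℝ] R4} (hΘ : IsSymplectic Θ) (h0 : Θ '' L0 = L0) :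
    IsFlatPlanarLagrangian (Θ '' L) := by
  obtain ⟨K, hK, hLK⟩ := h.2
  exact ⟨h.1.image hΘ, Θ '' K, hK.image Θ.contDiff.continuous, hLK.image h0⟩

theorem extendOne_image_L0 (h : ℝ ≃ₘ[ℝ] ℝ) (hd : ∀ x, 0 < deriv h x) :
    extendOne (liftPlane h hd) '' L0 = L0 := by
  ext p
  constructor
  · rintro ⟨p, ⟨h1, h2⟩, rfl⟩
    simp [extendOne_apply, liftPlane_apply, L0, h1, h2]
  · rintro ⟨h1, h2⟩
    refine ⟨(h.symm p.1, p.2.1, 0, 0), ⟨rfl, rfl⟩, ?_⟩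
    simp [extendOne_apply, liftPlane_apply, Prod.ext_iff, h1, h2]

theorem translateDiffeo_image_L0 (t : ℝ) : translateDiffeo t '' L0 = L0 := by
  ext p
  constructor
  · rintro ⟨p, ⟨h1, h2⟩, rfl⟩
    exact ⟨h1, h2⟩
  · rintro ⟨h1, h2⟩
    refine ⟨(p.1 - t, p.2.1, 0, 0), ⟨rfl, rfl⟩, ?_⟩
    simp [translateDiffeo_apply, translateX1, Prod.ext_iff, h1, h2]

/-- Transversality is preserved by a diffeomorphism that maps the level `b` of `y₂` to the level
`a` and whose derivative does not change the `y₂`-component there. -/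
theorem IsTransverse.image {L : Set R4} {a b : ℝ} (h : IsTransverse L b) {Θ : R4 ≃ₘ[ℝ] R4}
    (hl : ∀ p, y2 (Θ p) = a ↔ y2 p = b)
    (hd : ∀ p v, y2 p = b → y2 v ≠ 0 → y2 (fderiv ℝ Θ p v) ≠ 0) :
    IsTransverse (Θ '' L) a := by
  rintro _ ⟨⟨p, hp, rfl⟩, ha⟩
  obtain ⟨v, hv, h0⟩ := h p ⟨hp, (hl p).1 ha⟩
  exact ⟨_, hv.image Θ, hd p v ((hl p).1 ha) h0⟩

theorem level_image {L : Set R4} {a b : ℝ} {Θ : R4 ≃ₘ[ℝ] R4}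
    (hl : ∀ p, y2 (Θ p) = a ↔ y2 p = b) : level (Θ '' L) a = Θ '' level L b := by
  ext p
  constructor
  · rintro ⟨⟨p, hp, rfl⟩, ha⟩
    exact ⟨p, ⟨hp, (hl p).1 ha⟩, rfl⟩
  · rintro ⟨p, ⟨hp, hb⟩, rfl⟩
    exact ⟨⟨p, hp, rfl⟩, (hl p).2 hb⟩

/-! ### Joining two half-planes -/

theorem AgreesOutside.mem_iff {L K : Set R4} (h : AgreesOutside L K) {p : R4} (hp : p ∉ K) :
    p ∈ L ↔ p ∈ L0 :=
  ⟨fun hL => (h.subset ⟨hL, hp⟩).1, fun hL => (h.superset ⟨hL, hp⟩).1⟩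

theorem agreesOutside_of_mem_iff {L K : Set R4} (h : ∀ p ∉ K, p ∈ L ↔ p ∈ L0) :
    AgreesOutside L K := by
  ext p
  exact ⟨fun ⟨h1, h2⟩ => ⟨(h p h2).1 h1, h2⟩, fun ⟨h1, h2⟩ => ⟨(h p h2).2 h1, h2⟩⟩

theorem IsCompact.exists_pos_lt {α : Type*} [TopologicalSpace α] {K : Set α} (hK : IsCompact K)
    {f : α → ℝ} (hf : Continuous f) (h : ∀ p ∈ K, 0 < f p) : ∃ ε > 0, ∀ p ∈ K, ε < f p := by
  rcases K.eq_empty_or_nonempty with rfl | hne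
  · exact ⟨1, one_pos, by simp⟩
  · obtain ⟨x, hx, hmin⟩ := hK.exists_isMinOn hne hf.continuousOn
    refine ⟨f x / 2, half_pos (h x hx), fun p hp => ?_⟩
    have h1 := isMinOn_iff.1 hmin p hp
    have h2 := h x hx
    linarith

theorem IsCompact.exists_abs_lt {α : Type*} [TopologicalSpace α] {K : Set α} (hK : IsCompact K)
    {f : α → ℝ} (hf : Continuous f) : ∃ R > 0, ∀ p ∈ K, |f p| < R := by
  obtain ⟨C, hC⟩ := hK.exists_bound_of_continuousOn hf.continuousOn
  refine ⟨max C 0 + 1, by positivity, fun p hp => ?_⟩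
  have := hC p hp
  rw [Real.norm_eq_abs] at this
  linarith [le_max_left C 0]

/-- The left half of `L` together with the right half of `L'`. -/
def halves (L L' : Set R4) : Set R4 := (L ∩ {p | p.1 ≤ 0}) ∪ (L' ∩ {p | 0 ≤ p.1})

/-- The cut is invisible: over the strip 0 ≤ x₁ < ε both sets coincide with `L0`, so the union
continues L beyond the hyperplane. -/
theorem mem_halves_left {L L' K K' : Set R4} (hL : AgreesOutside L K) (hL' : AgreesOutside L' K')
    (hK : ∀ p ∈ K, p.1 < 0) {ε : ℝ} (hK' : ∀ p ∈ K', ε < p.1) {p : R4} (hp : p.1 < ε) :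
    p ∈ halves L L' ↔ p ∈ L := by
  have h1 : p ∈ L' ↔ p ∈ L0 := hL'.mem_iff fun h => (hK' p h).not_gt hp
  have h2 : 0 ≤ p.1 → (p ∈ L ↔ p ∈ L0) := fun h0 => hL.mem_iff fun h => (hK p h).not_ge h0
  simp only [halves, mem_union, mem_inter_iff, mem_ofPred_eq, h1]
  rcases lt_or_ge p.1 0 with h | h
  · simp [h.le, h.not_ge]
  · rw [h2 h]
    tauto

theorem mem_halves_right {L L' K K' : Set R4} (hL : AgreesOutside L K)
    (hL' : AgreesOutside L' K') {ε : ℝ} (hK : ∀ p ∈ K, p.1 < -ε) (hK' : ∀ p ∈ K', 0 < p.1)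
    {p : R4} (hp : -ε < p.1) : p ∈ halves L L' ↔ p ∈ L' := by
  have h1 : p ∈ L ↔ p ∈ L0 := hL.mem_iff fun h => (hK p h).not_gt hp
  have h2 : p.1 ≤ 0 → (p ∈ L' ↔ p ∈ L0) := fun h0 => hL'.mem_iff fun h => (hK' p h).not_ge h0
  simp only [halves, mem_union, mem_inter_iff, mem_ofPred_eq, h1]
  rcases lt_or_ge 0 p.1 with h | h
  · simp [h.le, h.not_ge]
  · rw [h2 h]
    tauto

/-- A compact subset of `{x₁ > η}` can be squeezed over a small neighbourhood of a point of the
`x₁x₂`-plane. -/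
theorem exists_squeeze {K : Set R4} (hK : IsCompact K) {η δ : ℝ} (hη : 0 < η) (hδ : 0 < δ)
    (hKη : ∀ p ∈ K, η < p.1) :
    ∃ Θ : R4 ≃ₘ[ℝ] R4, (∀ p : R4, p.1 ≤ 0 → Θ p = p) ∧ (∀ p : R4, 0 < p.1 → 0 < (Θ p).1) ∧
      (∀ p, Θ p ∈ L0 ↔ p ∈ L0) ∧ ∀ p ∈ K, projPlane (Θ p) ∈ Metric.ball (η, 0) δ := by
  obtain ⟨R, hR0, hR⟩ := IsCompact.exists_abs_lt hK (f := fun p : R4 => p.1) (by fun_prop)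
  obtain ⟨B, hB0, hB⟩ := IsCompact.exists_abs_lt hK (f := fun p : R4 => p.2.1) (by fun_prop)
  -- h moves the interval (η, η + R) into (η, η + δ/2), and the factor m below, equal to κ from η
  -- on, brings |x₂| < B below δ. The y-coordinates are untouched, so `L0` is preserved;
  -- symplecticity is not needed, since only the smooth structure is at stake.
  obtain ⟨h, hd, h1, h2⟩ := exists_shift (u := η) (c := η + R) (c' := η + δ / 2) (by linarith)
    (by linarith)
  have hmono : StrictMono h := strictMono_of_deriv_pos hd
  let κ : ℝ := min (1 / 2) (δ / B)
  have hκ : 0 < κ := by positivity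
  have hκ1 : κ ≤ 1 / 2 := min_le_left _ _
  let m : ℝ → ℝ := fun x => 1 + (κ - 1) * Real.smoothTransition (x / η)
  have hm : ContDiff ℝ ∞ m :=
    contDiff_const.add (contDiff_const.mul (Real.smoothTransition.contDiff.comp
      (contDiff_id.div_const _)))
  have hmpos : ∀ x, 0 < m x := by
    intro x
    have h3 := Real.smoothTransition.nonneg (x / η)
    have h4 := Real.smoothTransition.le_one (x / η)
    simp only [m]
    nlinarith
  have hm0 : ∀ x, x ≤ 0 → m x = 1 := by
    intro x hx
    simp [m, Real.smoothTransition.zero_of_nonpos (div_nonpos_of_nonpos_of_nonneg hx hη.le)]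
  have hm1 : ∀ x, η ≤ x → m x = κ := by
    intro x hx
    simp [m, Real.smoothTransition.one_of_one_le ((one_le_div hη).2 hx)]
  have hh : ContDiff ℝ ∞ h := h.contDiff
  have hhs : ContDiff ℝ ∞ h.symm := h.symm.contDiff
  let e : R4 ≃ R4 :=
    { toFun := fun p => (h p.1, m p.1 * p.2.1, p.2.2)
      invFun := fun p => (h.symm p.1, p.2.1 / m (h.symm p.1), p.2.2)
      left_inv := fun p => by simp [(hmpos p.1).ne']
      right_inv := fun p => by simp [mul_div_cancel₀, (hmpos (h.symm p.1)).ne'] }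
  have he : ContDiff ℝ ∞ e := by
    change ContDiff ℝ ∞ fun p : R4 => (h p.1, m p.1 * p.2.1, p.2.2)
    exact (hh.comp (by fun_prop)).prodMk (ContDiff.prodMk
      ((hm.comp (by fun_prop)).mul (by fun_prop)) (by fun_prop))
  have hes : ContDiff ℝ ∞ e.symm := by
    change ContDiff ℝ ∞ fun p : R4 => (h.symm p.1, p.2.1 / m (h.symm p.1), p.2.2)
    have hs1 : ContDiff ℝ ∞ fun p : R4 => h.symm p.1 := hhs.comp (by fun_prop)
    exact hs1.prodMk (ContDiff.prodMk
      (ContDiff.div (by fun_prop) (hm.comp hs1) fun p => (hmpos _).ne') (by fun_prop))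
  refine ⟨⟨e, he.contMDiff, hes.contMDiff⟩, fun p hp => ?_, fun p hp => ?_, fun p => Iff.rfl,
    fun p hp => ?_⟩
  · change (h p.1, m p.1 * p.2.1, p.2.2) = p
    rw [h1 _ (by linarith), hm0 _ hp, one_mul]
  · change 0 < h p.1
    rw [← h1 0 hη.le]
    exact hmono hp
  · change (h p.1, m p.1 * p.2.1) ∈ Metric.ball (η, (0 : ℝ)) δ
    have h3 := hKη p hp
    have h4 := hmono h3
    have h5 := hmono (show p.1 < η + R by linarith [(abs_lt.1 (hR p hp)).2])
    rw [h1 _ le_rfl] at h4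
    rw [h2 _ le_rfl] at h5
    rw [hm1 _ h3.le, mem_ball_iff_norm, Prod.norm_def, max_lt_iff]
    constructor
    · rw [Real.norm_eq_abs, abs_lt]
      constructor <;> simp only [Prod.fst_sub] <;> linarith
    · have h6 : κ ≤ δ / B := min_le_right _ _
      have h7 := hB p hp
      simp only [Prod.snd_sub, sub_zero, norm_mul, Real.norm_eq_abs, abs_of_pos hκ]
      calc κ * |p.2.1| < κ * B := by gcongr
        _ ≤ δ / B * B := by gcongr
        _ = δ := by field_simp

/-- Θ squeezes K' over a disc on which L has a standard parametrization. Gluing then applies to L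
itself and Θ(L'): Θ is the identity for x₁ ≤ 0, and for x₁ > 0 everything off Θ(K') is `L0`. Finally
Θ⁻¹ undoes the squeeze. -/
theorem isEmbeddedPlane_halves {L L' K K' : Set R4} (hLP : IsEmbeddedPlane L)
    (hLP' : IsEmbeddedPlane L') (hL : AgreesOutside L K) (hL' : AgreesOutside L' K')
    (hKc' : IsCompact K') (hK : ∀ p ∈ K, p.1 < 0) (hK' : ∀ p ∈ K', 0 < p.1) :
    IsEmbeddedPlane (halves L L') := by
  obtain ⟨η, hη, hKη⟩ := IsCompact.exists_pos_lt hKc' (f := fun p : R4 => p.1) (by fun_prop) hK'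
  have hflat : ∀ p : R4, 0 < p.1 → (p ∈ L ↔ p ∈ L0) :=
    fun p hp => hL.mem_iff fun h => (hK p h).not_gt hp
  obtain ⟨E, hE, hEc⟩ := exists_planeParam_standard hLP hflat (c := (η, 0)) hη
  obtain ⟨δ', hδ', hEδ⟩ := Metric.eventually_nhds_iff_ball.1 hEc
  obtain ⟨f, hf : IsPlaneParam f L'⟩ := hLP'
  let δ := min δ' η
  have hδ : 0 < δ := lt_min hδ' hη
  obtain ⟨Θ, hΘ0, hΘ1, hΘL, hΘK⟩ := exists_squeeze hKc' hη hδ hKη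
  have hU : ∀ p : R4, projPlane p ∈ Metric.ball (η, (0 : ℝ)) δ → 0 < p.1 := by
    intro p hp
    rw [mem_ball_iff_norm, Prod.norm_def, max_lt_iff, Real.norm_eq_abs, abs_lt] at hp
    have h1 := hp.1.1
    have h2 : δ ≤ η := min_le_right _ _
    simp only [projPlane, Prod.fst_sub] at h1
    linarith
  have hinj : Function.Injective Θ := Θ.injective
  obtain ⟨f', hf' : IsPlaneParam f' (Θ '' L')⟩ := IsEmbeddedPlane.image ⟨f, hf⟩ Θ
  have hpos : ∀ q, 0 < (Θ q).1 → 0 < q.1 := by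
    intro q hq
    by_contra hn
    rw [hΘ0 q (not_lt.1 hn)] at hq
    exact hn hq
  have hML : ∀ q : R4, q.1 ≤ 0 → (q ∈ halves L L' ↔ q ∈ L) := fun q hq =>
    mem_halves_left hL hL' hK hKη (by linarith)
  have hML' : ∀ q : R4, 0 < q.1 → (q ∈ halves L L' ↔ q ∈ L') := by
    intro q hq
    simp [halves, hq.le, hq.not_ge]
  have key : IsEmbeddedPlane (Θ '' halves L L') := by
    refine hE.glue (K := Θ '' K') (U := Metric.ball (η, (0 : ℝ)) δ) hf' Metric.isOpen_ball
      (fun z hz => hEδ z (Metric.ball_subset_ball (min_le_left _ _) hz))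
      (fun p hp => hflat p (hU p hp)) (hKc'.image Θ.contDiff.continuous).isClosed ?_
      (hL'.image ?_) ?_ ?_
    · rintro _ ⟨p, hp, rfl⟩
      exact hΘK p hp
    · ext p
      obtain ⟨q, rfl⟩ := Θ.surjective p
      rw [show Θ.toEquiv q = Θ q from rfl, hinj.mem_set_image, hΘL]
    · intro p hp
      obtain ⟨q, rfl⟩ := Θ.surjective p
      rw [show Θ.toEquiv q = Θ q from rfl] at hp ⊢
      rw [hinj.mem_set_image, hinj.mem_set_image]
      exact hML' q (hpos q (hU _ hp))
    · intro p hp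
      obtain ⟨q, rfl⟩ := Θ.surjective p
      rw [show Θ.toEquiv q = Θ q from rfl, hinj.mem_set_image] at hp ⊢
      rcases le_or_gt q.1 0 with h | h
      · rw [hΘ0 q h, hML q h]
      · rw [hML' q h, hL'.mem_iff hp, hflat _ (hΘ1 q h), hΘL]
  have := key.image Θ.symm
  rwa [image_symm_image] at this

theorem IsTangent.of_eventually {L M : Set R4} {p v : R4} (h : IsTangent L p v)
    (hLM : ∀ᶠ x in 𝓝 p, x ∈ L → x ∈ M) : IsTangent M p v := by
  obtain ⟨c, hc, rfl, hcL, rfl⟩ := h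
  refine ⟨c, hc, rfl, ?_, rfl⟩
  filter_upwards [hcL, hc.continuous.continuousAt.eventually hLM] with t h1 h2 using h2 h1

/-- The halves of two flat Lagrangian planes, each of them flat over the other half-space, form a
flat Lagrangian plane, with the expected levels. -/
theorem halves_properties {L L' K K' : Set R4} (hLP : IsPlanarLagrangian L)
    (hLP' : IsPlanarLagrangian L') (hL : AgreesOutside L K) (hL' : AgreesOutside L' K')
    (hKc : IsCompact K) (hKc' : IsCompact K') (hK : ∀ p ∈ K, p.1 < 0) (hK' : ∀ p ∈ K', 0 < p.1) :
    IsFlatPlanarLagrangian (halves L L') ∧ (∀ a, IsTransverse L a → IsTransverse L' a →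
      IsTransverse (halves L L') a) ∧
      ∀ a ≠ 0, level (halves L L') a = level L a ∪ level L' a := by
  obtain ⟨ε', hε', hKε'⟩ := IsCompact.exists_pos_lt hKc' (f := fun p : R4 => p.1) (by fun_prop) hK'
  obtain ⟨ε, hε, hKε⟩ := IsCompact.exists_pos_lt hKc (f := fun p : R4 => -p.1) (by fun_prop)
    fun p hp => neg_pos.2 (hK p hp)
  have hleft : ∀ p : R4, p.1 < ε' → (p ∈ halves L L' ↔ p ∈ L) :=
    fun p hp => mem_halves_left hL hL' hK hKε' hp
  have hright : ∀ p : R4, -ε < p.1 → (p ∈ halves L L' ↔ p ∈ L') :=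
    fun p hp => mem_halves_right hL hL' (fun q hq => by linarith [hKε q hq]) hK' hp
  -- The two regions overlap and cover everything, so conditions on tangent vectors can be checked
  -- in L or in L'.
  have hlocal : ∀ p : R4, (∀ᶠ x in 𝓝 p, x ∈ halves L L' ↔ x ∈ L) ∨
      (∀ᶠ x in 𝓝 p, x ∈ halves L L' ↔ x ∈ L') := by
    intro p
    rcases lt_or_ge p.1 ε' with h | h
    · left
      filter_upwards [(isOpen_lt continuous_fst continuous_const).mem_nhds h] with x hx
        using hleft x hx
    · right
      have h1 : -ε < p.1 := by linarith
      filter_upwards [(isOpen_lt continuous_const continuous_fst).mem_nhds h1] with x hx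
        using hright x hx
  -- `L0` lies in level 0, so the other levels lie in the compact set and hence strictly on one side
  -- of the cut.
  have hoff : ∀ (N J : Set R4), AgreesOutside N J → ∀ p ∈ N, y2 p ≠ 0 → p ∈ J := by
    intro N J hN p hp h0
    by_contra h
    exact h0 ((hN.mem_iff h).1 hp).2
  refine ⟨⟨⟨isEmbeddedPlane_halves hLP.1 hLP'.1 hL hL' hKc' hK hK', ?_⟩, K ∪ K',
    hKc.union hKc', agreesOutside_of_mem_iff ?_⟩, ?_, ?_⟩
  · intro p hp u v hu hv
    rcases hlocal p with h | h
    · exact hLP.2 p (h.self_of_nhds.1 hp) u v (hu.of_eventually (h.mono fun x hx => hx.1))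
        (hv.of_eventually (h.mono fun x hx => hx.1))
    · exact hLP'.2 p (h.self_of_nhds.1 hp) u v (hu.of_eventually (h.mono fun x hx => hx.1))
        (hv.of_eventually (h.mono fun x hx => hx.1))
  · intro p hp
    rw [mem_union, not_or] at hp
    rcases lt_or_ge p.1 ε' with h | h
    · rw [hleft p h, hL.mem_iff hp.1]
    · rw [hright p (by linarith), hL'.mem_iff hp.2]
  · rintro a ha ha' p ⟨hp, hpa⟩
    rcases hlocal p with h | h
    · obtain ⟨v, hv, h0⟩ := ha p ⟨h.self_of_nhds.1 hp, hpa⟩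
      exact ⟨v, hv.of_eventually (h.mono fun x hx => hx.2), h0⟩
    · obtain ⟨v, hv, h0⟩ := ha' p ⟨h.self_of_nhds.1 hp, hpa⟩
      exact ⟨v, hv.of_eventually (h.mono fun x hx => hx.2), h0⟩
  · intro a ha
    ext p
    constructor
    · rintro ⟨⟨h, _⟩ | ⟨h, _⟩, hpa⟩
      · exact Or.inl ⟨h, hpa⟩
      · exact Or.inr ⟨h, hpa⟩
    · rintro (⟨h, hpa⟩ | ⟨h, hpa⟩)
      · exact ⟨Or.inl ⟨h, (hK p (hoff L K hL p h (by rw [hpa]; exact ha))).le⟩, hpa⟩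
      · exact ⟨Or.inr ⟨h, (hK' p (hoff L' K' hL' p h (by rw [hpa]; exact ha))).le⟩, hpa⟩

/-! ### The Hamiltonian shift of levels -/

/-- The linear isotopy from the identity to an increasing diffeomorphism `h` of the line, lifted to
the `x₂y₂`-plane, is Hamiltonian. -/
theorem isHamiltonianDiffeo_extendTwo (h : ℝ ≃ₘ[ℝ] ℝ) (hd : ∀ x, 0 < deriv h x) {C : ℝ}
    (hC : ∀ x, |h x - x| ≤ C) : IsHamiltonianDiffeo (extendTwo (liftPlane h hd)) := by
  -- Reparametrizing time keeps s in [0, 1], so the isotopy exists for all real t: D is a convex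
  -- combination of 1 and h', hence positive.
  let s : ℝ → ℝ := Real.smoothTransition
  have hs : ContDiff ℝ ∞ s := Real.smoothTransition.contDiff
  have hs' : ContDiff ℝ ∞ (deriv s) := contDiff_deriv hs
  have hs0 : ∀ t, 0 ≤ s t := Real.smoothTransition.nonneg
  have hs1 : ∀ t, s t ≤ 1 := Real.smoothTransition.le_one
  let k : ℝ → ℝ := fun x => h x - x
  have hh : ContDiff ℝ ∞ h := h.contDiff
  have hh' : ContDiff ℝ ∞ (deriv h) := contDiff_deriv hh
  have hk : ContDiff ℝ ∞ k := hh.sub contDiff_id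
  have hhd : ∀ x, HasDerivAt h (deriv h x) x := fun x => (hh.differentiable (by simp) x).hasDerivAt
  have hkd : ∀ x, HasDerivAt k (deriv h x - 1) x := fun x => (hhd x).sub (hasDerivAt_id x)
  let D : ℝ → ℝ → ℝ := fun t x => 1 + s t * (deriv h x - 1)
  have hD : ∀ t x, 0 < D t x := by
    intro t x
    have := hd x
    have h0 := hs0 t
    rcases (hs1 t).eq_or_lt with h1 | h1
    · simp only [D, h1]
      linarith
    · simp only [D]
      nlinarith
  have hfd : ∀ t x, HasDerivAt (fun x => x + s t * k x) (D t x) x := fun t x =>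
    (hasDerivAt_id x).add ((hkd x).const_mul (s t))
  have hfs : ∀ t, ContDiff ℝ ∞ fun x => x + s t * k x := fun t =>
    contDiff_id.add (contDiff_const.mul hk)
  have hex : ∀ t, ∃ g : ℝ ≃ₘ[ℝ] ℝ, ⇑g = fun x => x + s t * k x := by
    intro t
    refine exists_diffeomorph_real (C := C) (hfs t) (fun x => ?_) fun x => ?_
    · rw [(hfd t x).deriv]
      exact hD t x
    · rw [add_sub_cancel_left, abs_mul, abs_of_nonneg (hs0 t)]
      exact (mul_le_of_le_one_left (abs_nonneg _) (hs1 t)).trans (hC x)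
  choose g hg using hex
  have hgd : ∀ t x, deriv (g t) x = D t x := fun t x => by rw [hg, (hfd t x).deriv]
  have hgpos : ∀ t x, 0 < deriv (g t) x := fun t x => by rw [hgd]; exact hD t x
  -- The track of the isotopy. Inverting it as a whole gives an inverse that is smooth in time and
  -- position jointly, as the smoothness of V requires.
  let w : ℝ × ℝ → ℝ × ℝ := fun z => (z.1, z.2 + s z.1 * k z.2)
  have hwg : ∀ t x, w (t, x) = (t, g t x) := fun t x => by rw [hg]
  have hw : ContDiff ℝ ∞ w := contDiff_fst.prodMk
    (contDiff_snd.add ((hs.comp contDiff_fst).mul (hk.comp contDiff_snd)))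
  have hwb : Function.Bijective w := by
    constructor
    · rintro ⟨t, x⟩ ⟨t', x'⟩ he
      rw [hwg, hwg, Prod.mk.injEq] at he
      obtain ⟨rfl, he⟩ := he
      rw [(g t).injective he]
    · rintro ⟨t, y⟩
      exact ⟨(t, (g t).symm y), by rw [hwg, (g t).apply_symm_apply]⟩
  obtain ⟨W, hW⟩ := exists_diffeomorph_of_bijective hw hwb fun z => by
    have hf : HasFDerivAt Prod.fst (ContinuousLinearMap.fst ℝ ℝ ℝ) z := hasFDerivAt_fst
    have hf' : HasFDerivAt Prod.snd (ContinuousLinearMap.snd ℝ ℝ ℝ) z := hasFDerivAt_snd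
    have e1 : HasFDerivAt (fun z : ℝ × ℝ => s z.1) _ z :=
      (hs.differentiable (by simp) z.1).hasDerivAt.comp_hasFDerivAt z hf
    have e2 : HasFDerivAt (fun z : ℝ × ℝ => k z.2) _ z := (hkd z.2).comp_hasFDerivAt z hf'
    have e3 : HasFDerivAt w _ z := hf.prodMk (hf'.add (e1.mul e2))
    obtain ⟨B, hB⟩ := exists_continuousLinearEquiv_of_injective (fderiv ℝ w z) <| by
      rw [injective_iff_map_eq_zero]
      rintro ⟨τ, η⟩ hv
      rw [e3.fderiv] at hv
      have hv1 := congrArg Prod.fst hv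
      have hv2 := congrArg Prod.snd hv
      simp at hv1 hv2
      subst hv1
      have hDz := hD z.1 z.2
      have : D z.1 z.2 * η = 0 := by
        simp only [D]
        linarith
      rcases mul_eq_zero.1 this with h0 | h0
      · exact absurd h0 hDz.ne'
      · rw [h0]
        rfl
    exact ⟨B, hB ▸ (hw.differentiable (by simp) z).hasFDerivAt⟩
  -- The velocity field of the isotopy of the y₂-line, expressed at the current position.
  let V : ℝ × ℝ → ℝ := fun z => deriv s z.1 * k (W.symm z).2
  have hWs : ContDiff ℝ ∞ W.symm := W.symm.contDiff
  have hV : ContDiff ℝ ∞ V := (hs'.comp contDiff_fst).mul (hk.comp hWs.snd)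
  have hVg : ∀ t x, V (t, g t x) = deriv s t * k x := by
    intro t x
    simp only [V]
    rw [← hwg, ← hW, W.symm_apply_apply]
  let Φ : ℝ → R4 ≃ₘ[ℝ] R4 := fun t => extendTwo (liftPlane (g t) (hgpos t))
  have hΦ : ∀ t p, Φ t p =
      (p.1, p.2.1 / D t p.2.2.2, p.2.2.1, p.2.2.2 + s t * k p.2.2.2) := by
    intro t p
    simp only [Φ, extendTwo_apply, liftPlane_apply, hgd]
    rw [hg]
  -- The Hamiltonian is -x₂ V(t, y₂). With this sign convention its equations are y₂' = V and x₂' =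
  -- -x₂ ∂V/∂y₂, which the lifted isotopy satisfies.
  refine ⟨fun z => -(z.2.2.1 * V (z.1, z.2.2.2.2)), Φ, ?_, ?_, fun p => ?_, fun p => ?_, ?_⟩
  · exact ((by fun_prop : ContDiff ℝ ∞ fun z : ℝ × R4 => z.2.2.1).mul
      (hV.comp (by fun_prop))).neg
  · simp only [hΦ]
    refine ContDiff.prodMk (by fun_prop) (ContDiff.prodMk ?_ (ContDiff.prodMk (by fun_prop) ?_))
    · refine ContDiff.div (by fun_prop) ?_ fun z => (hD _ _).ne'
      exact contDiff_const.add ((hs.comp contDiff_fst).mul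
        ((hh'.comp (by fun_prop)).sub contDiff_const))
    · exact ContDiff.add (by fun_prop) ((hs.comp contDiff_fst).mul (hk.comp (by fun_prop)))
  · have h0 : s 0 = 0 := Real.smoothTransition.zero
    rw [hΦ]
    simp [D, h0]
  · have h1 : s 1 = 1 := Real.smoothTransition.one
    rw [hΦ, extendTwo_apply, liftPlane_apply]
    simp [D, h1, k]
  · rintro t ⟨x₁, x₂, y₁, y₂⟩ v
    have hst : HasDerivAt s (deriv s t) t := (hs.differentiable (by simp) t).hasDerivAt
    have e1 : HasDerivAt (fun t => D t y₂) (deriv s t * (deriv h y₂ - 1)) t :=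
      (hst.mul_const _).const_add 1
    have e2 : HasDerivAt (fun t => x₂ / D t y₂) _ t := (hasDerivAt_const t x₂).div e1 (hD t y₂).ne'
    have e3 : HasDerivAt (fun t => y₂ + s t * k y₂) (deriv s t * k y₂) t :=
      (hst.mul_const _).const_add y₂
    have e4 := (hasDerivAt_const t x₁).prodMk (e2.prodMk ((hasDerivAt_const t y₁).prodMk e3))
    have e5 : (fun t => Φ t (x₁, x₂, y₁, y₂)) =
        fun t => (x₁, x₂ / D t y₂, y₁, y₂ + s t * k y₂) := funext fun t => hΦ t _
    rw [e5, e4.deriv]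
    have f1 : DifferentiableAt ℝ (fun y => V (t, y)) (g t y₂) :=
      (hV.comp (by fun_prop : ContDiff ℝ ∞ fun y : ℝ => (t, y))).differentiable (by simp) _
    have f2 : deriv (fun y => V (t, y)) (g t y₂) * D t y₂ = deriv s t * (deriv h y₂ - 1) := by
      have f3 : HasDerivAt (g t) (D t y₂) y₂ := by rw [hg]; exact hfd t y₂
      have f4 := f1.hasDerivAt.comp y₂ f3
      have f5 : ((fun y => V (t, y)) ∘ g t) = fun x => deriv s t * k x := funext fun x => hVg t x
      rw [f5] at f4
      exact f4.unique ((hkd y₂).const_mul _)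
    let A : R4 →L[ℝ] ℝ := ContinuousLinearMap.fst ℝ ℝ _ ∘L ContinuousLinearMap.snd ℝ ℝ _
    let B : R4 →L[ℝ] ℝ := ContinuousLinearMap.snd ℝ ℝ _ ∘L ContinuousLinearMap.snd ℝ ℝ _ ∘L
      ContinuousLinearMap.snd ℝ ℝ _
    let P : R4 := Φ t (x₁, x₂, y₁, y₂)
    have hBP : B P = g t y₂ := by rw [hg]; exact congrArg (fun p : R4 => p.2.2.2) (hΦ t _)
    have hAP : A P = x₂ / D t y₂ := congrArg (fun p : R4 => p.2.1) (hΦ t _)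
    have f6 : HasDerivAt (fun y => V (t, y)) (deriv (fun y => V (t, y)) (B P)) (B P) := by
      rw [← hBP] at f1
      exact f1.hasDerivAt
    have g1 := ((A.hasFDerivAt (x := P)).mul
      (f6.comp_hasFDerivAt (f := B) P (B.hasFDerivAt (x := P)))).neg
    have g2 : fderiv ℝ (fun q : R4 => -(q.2.1 * V (t, q.2.2.2))) (Φ t (x₁, x₂, y₁, y₂)) = _ :=
      g1.fderiv
    rw [g2]
    have hV1 : V (t, B P) = deriv s t * k y₂ := by rw [hBP, hVg]
    have hV2 : deriv (fun y => V (t, y)) (B P) = deriv s t * (deriv h y₂ - 1) / D t y₂ := by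
      rw [hBP, eq_div_iff (hD t y₂).ne', f2]
    have hA : A v = v.2.1 := rfl
    have hB : B v = v.2.2.2 := rfl
    simp only [omega, neg_apply, add_apply, smul_apply, smul_eq_mul, hA, hB, hV2, hAP]
    rw [Function.comp_apply, hV1]
    have := (hD t y₂).ne'
    field_simp
    ring

/-- There is a Hamiltonian diffeomorphism that shifts one negative level to another one. -/
theorem exists_levelShift {a b : ℝ} (ha : a < 0) (hb : b < 0) :
    ∃ ψ : R4 ≃ₘ[ℝ] R4, IsHamiltonianDiffeo ψ ∧ ShiftsLevel ψ b a ∧ IsSymplectic ψ ∧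
      ψ '' L0 = L0 ∧ (∀ p, (ψ p).1 = p.1) ∧ (∀ p, y2 (ψ p) = a ↔ y2 p = b) ∧
      ∀ p v, y2 p = b → y2 v ≠ 0 → y2 (fderiv ℝ ψ p v) ≠ 0 := by
  obtain ⟨m, hm, ham, hbm⟩ : ∃ m < 0, a ≤ m ∧ b ≤ m :=
    ⟨max a b, max_lt ha hb, le_max_left _ _, le_max_right _ _⟩
  -- As m < 0, the translation range y₂ ≤ b - m/4 contains a neighbourhood of {y₂ ≤ b}, so h' = 1
  -- there. Likewise β = m/4 lies strictly above m/2, where h becomes the identity. Both b - m/4 and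
  -- a - m/4 are at most 3m/4 < m/2.
  obtain ⟨h, hd, h1, h2⟩ := exists_shift_left (u := m / 2) (c := b - m / 4) (c' := a - m / 4)
    (by linarith) (by linarith)
  have h2' : ∀ x ≤ b - m / 4, h x = x + (a - b) := fun x hx => by rw [h2 x hx]; ring
  have hh : ContDiff ℝ ∞ h := h.contDiff
  obtain ⟨C, hC⟩ : ∃ C, ∀ x, |h x - x| ≤ C := by
    obtain ⟨C, hC⟩ := (isCompact_Icc (a := b - m / 4) (b := m / 2)).exists_bound_of_continuousOn
      (hh.continuous.sub continuous_id).continuousOn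
    refine ⟨max C |a - b|, fun x => ?_⟩
    rcases le_or_gt x (b - m / 4) with hx | hx
    · rw [h2' x hx, add_sub_cancel_left]
      exact le_max_right _ _
    · rcases le_or_gt x (m / 2) with hx' | hx'
      · exact (hC x ⟨hx.le, hx'⟩).trans (le_max_left _ _)
      · rw [h1 x hx'.le, sub_self, abs_zero]
        exact (abs_nonneg _).trans (le_max_right _ _)
  have hderiv : ∀ x < b - m / 4, deriv h x = 1 := by
    intro x hx
    have h3 : h =ᶠ[𝓝 x] fun y => y + (a - b) := by
      filter_upwards [Iio_mem_nhds hx] with y hy using h2' y (le_of_lt hy)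
    rw [h3.deriv_eq]
    simp
  have hid : ∀ p, m / 4 ≤ y2 p → extendTwo (liftPlane h hd) p = p := by
    intro p hp
    rw [y2] at hp
    rw [extendTwo_apply, liftPlane_eq_self h hd (isOpen_Ioi (a := m / 2))
      (fun x hx => h1 x (le_of_lt hx)) (show p.2.2.2 ∈ Ioi (m / 2) by rw [mem_Ioi]; linarith)]
  have hy2 : ∀ p, y2 (extendTwo (liftPlane h hd) p) = h (y2 p) := fun p => rfl
  refine ⟨extendTwo (liftPlane h hd), isHamiltonianDiffeo_extendTwo h hd hC,
    ⟨⟨m / 4, by linarith, by linarith, hid⟩, fun p hp => ?_⟩,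
    isSymplectic_extendTwo (liftPlane_fderiv_det h hd), ?_, fun p => rfl, fun p => ?_, ?_⟩
  · rw [y2] at hp
    rw [extendTwo_apply, liftPlane_apply, h2' _ (by linarith), hderiv _ (by linarith)]
    simp
  · have h3 : ∀ p ∈ L0, extendTwo (liftPlane h hd) p = p := fun p hp =>
      hid p (by rw [y2, hp.2]; linarith)
    rw [image_congr h3, image_id']
  · have hb' : h b = a := by rw [h2' b (by linarith)]; ring
    rw [hy2, ← hb']
    exact h.injective.eq_iff
  · intro p v _ hv
    rw [fderiv_extendTwo]
    have h3 : (fderiv ℝ (liftPlane h hd) (p.2.2.2, p.2.1) (v.2.2.2, v.2.1)).1 =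
        deriv h p.2.2.2 * v.2.2.2 := by
      have hf : HasFDerivAt Prod.fst (ContinuousLinearMap.fst ℝ ℝ ℝ) (p.2.2.2, p.2.1) :=
        hasFDerivAt_fst
      have h4 : HasFDerivAt (fun z : ℝ × ℝ => (liftPlane h hd z).1) _ (p.2.2.2, p.2.1) :=
        (hh.differentiable (by simp) p.2.2.2).hasDerivAt.comp_hasFDerivAt (p.2.2.2, p.2.1) hf
      have h5 := ((liftPlane h hd).contDiff.differentiable (by simp)
        (p.2.2.2, p.2.1)).hasFDerivAt.fst
      have h6 := congrArg (fun A : ℝ × ℝ →L[ℝ] ℝ => A (v.2.2.2, v.2.1)) (h5.unique h4)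
      simpa using h6
    rw [y2, h3]
    exact mul_ne_zero (hd _).ne' hv

/-! ### Moving and localizing equivalences of slices -/

/-- The rotation of the plane by an angle that depends on the distance from the origin. -/
noncomputable def twistFun (θ : ℝ → ℝ) (z : ℝ × ℝ) : ℝ × ℝ :=
  (z.1 * Real.cos (θ (z.1 ^ 2 + z.2 ^ 2)) - z.2 * Real.sin (θ (z.1 ^ 2 + z.2 ^ 2)),
    z.1 * Real.sin (θ (z.1 ^ 2 + z.2 ^ 2)) + z.2 * Real.cos (θ (z.1 ^ 2 + z.2 ^ 2)))

theorem twistFun_neg (θ : ℝ → ℝ) (z : ℝ × ℝ) : twistFun (-θ) (twistFun θ z) = z := by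
  have h := Real.sin_sq_add_cos_sq (θ (z.1 ^ 2 + z.2 ^ 2))
  have h1 : (twistFun θ z).1 ^ 2 + (twistFun θ z).2 ^ 2 = z.1 ^ 2 + z.2 ^ 2 := by
    simp only [twistFun]
    linear_combination (z.1 ^ 2 + z.2 ^ 2) * h
  rw [twistFun, h1]
  simp only [Pi.neg_apply, Real.cos_neg, Real.sin_neg, twistFun]
  ext <;> simp only
  · linear_combination z.1 * h
  · linear_combination z.2 * h

theorem contDiff_twistFun {θ : ℝ → ℝ} (hθ : ContDiff ℝ ∞ θ) : ContDiff ℝ ∞ (twistFun θ) := by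
  have h : ContDiff ℝ ∞ fun z : ℝ × ℝ => θ (z.1 ^ 2 + z.2 ^ 2) := hθ.comp (by fun_prop)
  unfold twistFun
  fun_prop

/-- `twistFun` as a diffeomorphism. -/
noncomputable def twist (θ : ℝ → ℝ) (hθ : ContDiff ℝ ∞ θ) : (ℝ × ℝ) ≃ₘ[ℝ] (ℝ × ℝ) where
  toFun := twistFun θ
  invFun := twistFun (-θ)
  left_inv := twistFun_neg θ
  right_inv z := by simpa using twistFun_neg (-θ) z
  contMDiff_toFun := (contDiff_twistFun hθ).contMDiff
  contMDiff_invFun := (contDiff_twistFun hθ.neg).contMDiff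

/-- In polar coordinates the map adds a function of the radius to the angle: a shear, which
preserves area. -/
theorem twist_fderiv_det (θ : ℝ → ℝ) (hθ : ContDiff ℝ ∞ θ) (z : ℝ × ℝ) :
    (fderiv ℝ (twist θ hθ) z).det = 1 := by
  have hf : HasFDerivAt Prod.fst (ContinuousLinearMap.fst ℝ ℝ ℝ) z := hasFDerivAt_fst
  have hs : HasFDerivAt Prod.snd (ContinuousLinearMap.snd ℝ ℝ ℝ) z := hasFDerivAt_snd
  have hq := (hf.pow 2).add (hs.pow 2)
  have hθq := ((hθ.differentiable (by simp) (z.1 ^ 2 + z.2 ^ 2)).hasDerivAt).comp_hasFDerivAt z hq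
  have h1 := (hf.mul hθq.cos).sub (hs.mul hθq.sin)
  have h2 := (hf.mul hθq.sin).add (hs.mul hθq.cos)
  have h3 : fderiv ℝ (twist θ hθ) z = _ := (h1.prodMk h2).fderiv
  rw [h3, continuousLinearMap_det_prod]
  simp
  linear_combination Real.sin_sq_add_cos_sq (θ (z.1 ^ 2 + z.2 ^ 2))

/-- The translation of the plane by `c` in the first coordinate. -/
noncomputable def translatePlane (c : ℝ) : (ℝ × ℝ) ≃ₘ[ℝ] (ℝ × ℝ) where
  toFun z := (z.1 + c, z.2)
  invFun z := (z.1 - c, z.2)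
  left_inv z := by simp
  right_inv z := by simp
  contMDiff_toFun := by
    refine ContDiff.contMDiff ?_
    change ContDiff ℝ ∞ fun z : ℝ × ℝ => (z.1 + c, z.2)
    fun_prop
  contMDiff_invFun := by
    refine ContDiff.contMDiff ?_
    change ContDiff ℝ ∞ fun z : ℝ × ℝ => (z.1 - c, z.2)
    fun_prop

theorem translatePlane_fderiv_det (c : ℝ) (z : ℝ × ℝ) :
    (fderiv ℝ (translatePlane c) z).det = 1 := by
  have h : ⇑(translatePlane c) = fun z => z + (c, 0) := by
    funext z
    change (z.1 + c, z.2) = _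
    ext <;> simp
  rw [h, fderiv_add_const, fderiv_fun_id]
  exact LinearMap.det_id

/-- There is a compactly supported area-preserving diffeomorphism of the plane that agrees with a
point reflection on a given disc. -/
theorem exists_pointReflection (c : ℝ) {r : ℝ} (hr : 0 ≤ r) :
    ∃ φ : (ℝ × ℝ) ≃ₘ[ℝ] (ℝ × ℝ), IsCompactAreaPreserving φ ∧
      ∀ z : ℝ × ℝ, (z.1 - c) ^ 2 + z.2 ^ 2 ≤ r → φ z = (2 * c - z.1, -z.2) := by
  -- The argument is the squared distance from the centre: the angle is π up to r and 0 from r + 1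
  -- on.
  let θ : ℝ → ℝ := fun q => Real.pi * (1 - Real.smoothTransition (q - r))
  have hθ : ContDiff ℝ ∞ θ := contDiff_const.mul (contDiff_const.sub
    (Real.smoothTransition.contDiff.comp (contDiff_id.sub contDiff_const)))
  let φ := ((translatePlane c).symm.trans (twist θ hθ)).trans (translatePlane c)
  have hφ : ∀ z, φ z = ((twistFun θ (z.1 - c, z.2)).1 + c, (twistFun θ (z.1 - c, z.2)).2) :=
    fun z => rfl
  refine ⟨φ, ⟨⟨Metric.closedBall (c, 0) (r + 2), isCompact_closedBall _ _, fun z hz => ?_⟩,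
    fderiv_det_trans (fderiv_det_trans (fderiv_det_symm (translatePlane_fderiv_det c))
      (twist_fderiv_det θ hθ)) (translatePlane_fderiv_det c)⟩, fun z hz => ?_⟩
  · rw [mem_closedBall_iff_norm, not_le, Prod.norm_def, lt_max_iff] at hz
    simp only [Prod.fst_sub, Prod.snd_sub, sub_zero, Real.norm_eq_abs] at hz
    have h1 : r + 1 ≤ (z.1 - c) ^ 2 + z.2 ^ 2 := by
      rw [← sq_abs (z.1 - c), ← sq_abs z.2]
      rcases hz with hz | hz
      · nlinarith [sq_nonneg |z.2|]
      · nlinarith [sq_nonneg |z.1 - c|]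
    have h2 : θ ((z.1 - c) ^ 2 + z.2 ^ 2) = 0 := by
      simp only [θ]
      rw [Real.smoothTransition.one_of_one_le (by linarith), sub_self, mul_zero]
    rw [hφ]
    simp [twistFun, h2]
  · have h2 : θ ((z.1 - c) ^ 2 + z.2 ^ 2) = Real.pi := by
      simp only [θ]
      rw [Real.smoothTransition.zero_of_nonpos (by linarith), sub_zero, mul_one]
    rw [hφ]
    simp only [twistFun, h2, Real.cos_pi, Real.sin_pi]
    ext <;> simp only <;> ring

/-- Translation by `t` in the `x₁`-direction of three-space. -/
def translateThree (t : ℝ) (p : R3) : R3 := (p.1 + t, p.2.1, p.2.2)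

/-- The reflection in 0 followed by the reflection in t/2 is the translation by t. The translation
itself is not compactly supported, but only its effect on S matters. -/
theorem sliceEquiv_translate {S : Set R3} (hS : IsCompact S) (t : ℝ) :
    SliceEquiv S (translateThree t '' S) := by
  obtain ⟨r, hr, h1⟩ := IsCompact.exists_abs_lt hS
    (f := fun p : R3 => (p.1 - 0) ^ 2 + p.2.2 ^ 2) (by fun_prop)
  -- The second disc, centred at t/2, has to contain the reflected points -p.
  obtain ⟨r', hr', h2⟩ := IsCompact.exists_abs_lt hS
    (f := fun p : R3 => (-p.1 - t / 2) ^ 2 + (-p.2.2) ^ 2) (by fun_prop)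
  obtain ⟨φ, hφ, hφr⟩ := exists_pointReflection 0 hr.le
  obtain ⟨χ, hχ, hχr⟩ := exists_pointReflection (t / 2) hr'.le
  have h3 : SliceEquiv S (timesId φ '' S) := ⟨φ, hφ, rfl⟩
  have h4 : SliceEquiv (timesId φ '' S) (timesId χ '' (timesId φ '' S)) := ⟨χ, hχ, rfl⟩
  have h5 : timesId χ '' (timesId φ '' S) = translateThree t '' S := by
    rw [image_image]
    refine image_congr fun p hp => ?_
    have e1 := hφr (p.1, p.2.2) ((le_abs_self _).trans (h1 p hp).le)
    simp only [mul_zero, zero_sub] at e1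
    have e2 := hχr (-p.1, -p.2.2) ((le_abs_self _).trans (h2 p hp).le)
    simp only [timesId, e1, e2, translateThree]
    ext <;> simp only <;> ring
  rw [← h5]
  exact sliceEquiv_trans h3 h4

/-- Conjugating by the lift of a diffeomorphism of the line moves the support of an
area-preserving diffeomorphism without changing its effect where the former is the identity. -/
theorem exists_conj_liftPlane {φ : (ℝ × ℝ) ≃ₘ[ℝ] (ℝ × ℝ)} (hdet : ∀ p, (fderiv ℝ φ p).det = 1)
    {K : Set (ℝ × ℝ)} (hK : ∀ p ∉ K, φ p = p) (h : ℝ ≃ₘ[ℝ] ℝ) (hd : ∀ x, 0 < deriv h x)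
    {s : Set ℝ} (hs : IsOpen s) (hh : ∀ x ∈ s, h x = x) {S T : Set R3}
    (hST : timesId φ '' S = T) (hSs : ∀ p ∈ S, p.1 ∈ s) (hTs : ∀ p ∈ T, p.1 ∈ s) :
    ∃ χ : (ℝ × ℝ) ≃ₘ[ℝ] (ℝ × ℝ), (∀ p, (fderiv ℝ χ p).det = 1) ∧
      (∀ p ∉ liftPlane h hd '' K, χ p = p) ∧ timesId χ '' S = T := by
  let P := liftPlane h hd
  have hP : ∀ z : ℝ × ℝ, z.1 ∈ s → P z = z := fun z hz => liftPlane_eq_self h hd hs hh hz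
  have hPs : ∀ z : ℝ × ℝ, z.1 ∈ s → P.symm z = z := fun z hz => by
    conv_lhs => rw [← hP z hz]
    exact P.symm_apply_apply z
  have hχ : ∀ z, (P.symm.trans φ).trans P z = P (φ (P.symm z)) := fun z => rfl
  refine ⟨(P.symm.trans φ).trans P, fderiv_det_trans (fderiv_det_trans
    (fderiv_det_symm (liftPlane_fderiv_det h hd)) hdet) (liftPlane_fderiv_det h hd),
    fun z hz => ?_, ?_⟩
  · have h1 : P.symm z ∉ K := fun h1 => hz ⟨_, h1, P.apply_symm_apply z⟩
    rw [hχ, hK _ h1, P.apply_symm_apply]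
  · rw [← hST]
    refine image_congr fun p hp => ?_
    have h1 : timesId φ p ∈ T := hST ▸ mem_image_of_mem _ hp
    have h2 := hTs _ h1
    simp only [timesId] at h2
    simp only [timesId, hχ]
    rw [hPs _ (hSs p hp), hP _ h2]

/-- The given equivalence is conjugated by a lift that is the identity near S and T and carries the
support into {x₁ < 0}. -/
theorem SliceEquiv.exists_left {S T : Set R3} (h : SliceEquiv S T) (hS : IsCompact S)
    (hT : IsCompact T) (hS0 : ∀ p ∈ S, p.1 < 0) (hT0 : ∀ p ∈ T, p.1 < 0) :
    ∃ (χ : (ℝ × ℝ) ≃ₘ[ℝ] (ℝ × ℝ)) (K : Set (ℝ × ℝ)), (∀ p, (fderiv ℝ χ p).det = 1) ∧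
      IsCompact K ∧ (∀ p ∈ K, p.1 < 0) ∧ (∀ p ∉ K, χ p = p) ∧ timesId χ '' S = T := by
  obtain ⟨φ, ⟨⟨K, hK, hKφ⟩, hdet⟩, hST⟩ := h
  obtain ⟨R, hR0, hR⟩ := IsCompact.exists_abs_lt hK (f := fun z : ℝ × ℝ => z.1) (by fun_prop)
  obtain ⟨ε, hε, hεST⟩ := IsCompact.exists_pos_lt (hS.union hT) (f := fun p : R3 => -p.1)
    (by fun_prop) fun p hp => neg_pos.2 (hp.elim (hS0 p) (hT0 p))
  -- h sends R to -ε/2, so the support, which lies in |x₁| < R, ends up to the left of -ε/2.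
  obtain ⟨h, hd, h1, h2⟩ := exists_shift (u := -ε) (c := R) (c' := -ε / 2) (by linarith)
    (by linarith)
  obtain ⟨χ, hχd, hχ, hχS⟩ := exists_conj_liftPlane hdet hKφ h hd (s := Iio (-ε)) isOpen_Iio
    (fun x hx => h1 x (le_of_lt hx)) hST
    (fun p hp => mem_Iio.2 (by linarith [hεST p (Or.inl hp)]))
    (fun p hp => mem_Iio.2 (by linarith [hεST p (Or.inr hp)]))
  refine ⟨χ, _, hχd, hK.image (liftPlane h hd).contDiff.continuous, ?_, hχ, hχS⟩
  rintro _ ⟨z, hz, rfl⟩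
  have h3 : h z.1 < h R := strictMono_of_deriv_pos hd (abs_lt.1 (hR z hz)).2
  rw [h2 R le_rfl] at h3
  rw [liftPlane_apply]
  simp only
  linarith

theorem SliceEquiv.exists_right {S T : Set R3} (h : SliceEquiv S T) (hS : IsCompact S)
    (hT : IsCompact T) (hS0 : ∀ p ∈ S, 0 < p.1) (hT0 : ∀ p ∈ T, 0 < p.1) :
    ∃ (χ : (ℝ × ℝ) ≃ₘ[ℝ] (ℝ × ℝ)) (K : Set (ℝ × ℝ)), (∀ p, (fderiv ℝ χ p).det = 1) ∧
      IsCompact K ∧ (∀ p ∈ K, 0 < p.1) ∧ (∀ p ∉ K, χ p = p) ∧ timesId χ '' S = T := by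
  obtain ⟨φ, ⟨⟨K, hK, hKφ⟩, hdet⟩, hST⟩ := h
  obtain ⟨R, hR0, hR⟩ := IsCompact.exists_abs_lt hK (f := fun z : ℝ × ℝ => z.1) (by fun_prop)
  obtain ⟨ε, hε, hεST⟩ := IsCompact.exists_pos_lt (hS.union hT) (f := fun p : R3 => p.1)
    (by fun_prop) fun p hp => hp.elim (hS0 p) (hT0 p)
  obtain ⟨h, hd, h1, h2⟩ := exists_shift_left (u := ε) (c := -R) (c' := ε / 2) (by linarith)
    (by linarith)
  obtain ⟨χ, hχd, hχ, hχS⟩ := exists_conj_liftPlane hdet hKφ h hd (s := Ioi ε) isOpen_Ioi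
    (fun x hx => h1 x (le_of_lt hx)) hST
    (fun p hp => hεST p (Or.inl hp)) (fun p hp => hεST p (Or.inr hp))
  refine ⟨χ, _, hχd, hK.image (liftPlane h hd).contDiff.continuous, ?_, hχ, hχS⟩
  rintro _ ⟨z, hz, rfl⟩
  have h3 : h (-R) < h z.1 := strictMono_of_deriv_pos hd (abs_lt.1 (hR z hz)).1
  rw [h2 (-R) le_rfl] at h3
  rw [liftPlane_apply]
  simp only
  linarith

/-- Localized equivalences do not interfere: the right one fixes S, and the left one fixes T'. -/
theorem SliceEquiv.union {S T S' T' : Set R3} (h : SliceEquiv S T) (h' : SliceEquiv S' T')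
    (hS : IsCompact S) (hT : IsCompact T) (hS' : IsCompact S') (hT' : IsCompact T')
    (hS0 : ∀ p ∈ S, p.1 < 0) (hT0 : ∀ p ∈ T, p.1 < 0) (hS0' : ∀ p ∈ S', 0 < p.1)
    (hT0' : ∀ p ∈ T', 0 < p.1) : SliceEquiv (S ∪ S') (T ∪ T') := by
  obtain ⟨χ, K, hd, hK, hK0, hχ, rfl⟩ := h.exists_left hS hT hS0 hT0
  obtain ⟨χ', K', hd', hK', hK0', hχ', rfl⟩ := h'.exists_right hS' hT' hS0' hT0'
  refine ⟨χ'.trans χ, ⟨⟨K ∪ K', hK.union hK', fun p hp => ?_⟩, fderiv_det_trans hd' hd⟩, ?_⟩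
  · rw [mem_union, not_or] at hp
    rw [Diffeomorph.coe_trans, Function.comp_apply, hχ' p hp.2, hχ p hp.1]
  · rw [image_union]
    congr 1
    · refine image_congr fun p hp => ?_
      have h1 : χ' (p.1, p.2.2) = (p.1, p.2.2) :=
        hχ' _ fun h => (hK0' _ h).not_gt (hS0 p hp)
      simp only [timesId, Diffeomorph.coe_trans, Function.comp_apply, h1]
    · refine image_congr fun p hp => ?_
      have h1 : χ (χ' (p.1, p.2.2)) = χ' (p.1, p.2.2) :=
        hχ _ fun h => (hK0 _ h).not_gt (hT0' _ (mem_image_of_mem _ hp))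
      simp only [timesId, Diffeomorph.coe_trans, Function.comp_apply, h1]

/-! ### Links, translated slices and unions of slices -/

theorem isLink_of_fintype {ι : Type*} [Fintype ι] {γ : ι → ℝ → R3}
    (h : ∀ i, ContDiff ℝ ∞ (γ i) ∧ Function.Periodic (γ i) 1 ∧ (∀ t, deriv (γ i) t ≠ 0) ∧
      InjOn (γ i) (Ico 0 1))
    (hdis : ∀ i j, i ≠ j → Disjoint (range (γ i)) (range (γ j))) :
    IsLink (⋃ i, range (γ i)) := by
  let e := Fintype.equivFin ι
  refine ⟨_, γ ∘ e.symm, fun i => h _, fun i j hij => hdis _ _ (e.symm.injective.ne hij), ?_⟩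
  exact (e.symm.surjective.iUnion_comp fun i => range (γ i)).symm

theorem IsLink.isCompact {S : Set R3} (h : IsLink S) : IsCompact S := by
  obtain ⟨n, γ, h1, -, rfl⟩ := h
  refine isCompact_iUnion fun i => ?_
  rw [← (h1 i).2.1.image_Icc one_pos 0]
  exact isCompact_Icc.image (h1 i).1.continuous

theorem IsLink.union {S S' : Set R3} (h : IsLink S) (h' : IsLink S') (hd : Disjoint S S') :
    IsLink (S ∪ S') := by
  obtain ⟨n, γ, h1, h2, rfl⟩ := h
  obtain ⟨n', γ', h1', h2', rfl⟩ := h'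
  have hcross : ∀ i j, Disjoint (range (γ i)) (range (γ' j)) := fun i j =>
    hd.mono (subset_iUnion (fun i => range (γ i)) i) (subset_iUnion (fun i => range (γ' i)) j)
  have := isLink_of_fintype (γ := Sum.elim γ γ') (Sum.rec h1 h1') <| by
    rintro (i | i) (j | j) hij
    · exact h2 i j fun e => hij (congrArg _ e)
    · exact hcross i j
    · exact (hcross j i).symm
    · exact h2' i j fun e => hij (congrArg _ e)
  rwa [iUnion_sum] at this

theorem translateThree_injective (t : ℝ) : Function.Injective (translateThree t) := by
  intro p q h
  simp only [translateThree, Prod.mk.injEq, add_left_inj] at h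
  exact Prod.ext h.1 (Prod.ext h.2.1 h.2.2)

theorem IsLink.translate {S : Set R3} (h : IsLink S) (t : ℝ) : IsLink (translateThree t '' S) := by
  obtain ⟨n, γ, h1, h2, rfl⟩ := h
  have hinj := translateThree_injective t
  have ht : translateThree t = fun p => p + (t, 0, 0) := by
    funext p
    simp [translateThree, Prod.ext_iff]
  refine ⟨n, fun i => translateThree t ∘ γ i, fun i => ⟨?_, ?_, fun s => ?_, ?_⟩,
    fun i j hij => ?_, ?_⟩
  · rw [ht]
    exact (h1 i).1.add contDiff_const
  · exact (h1 i).2.1.comp _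
  · have : deriv (translateThree t ∘ γ i) s = deriv (γ i) s := by
      rw [ht]
      exact deriv_add_const (f := γ i) _
    rw [this]
    exact (h1 i).2.2.1 s
  · exact hinj.comp_injOn (h1 i).2.2.2
  · rw [range_comp, range_comp]
    exact (disjoint_image_iff hinj).2 (h2 i j hij)
  · rw [image_iUnion]
    simp only [range_comp]

theorem isCompact_of_mem_slices {S : Set R3} (h : S ∈ Slices) : IsCompact S := by
  rcases h with h | rfl
  · exact h.1.isCompact
  · exact isCompact_empty

theorem IsTransverse.translate {L : Set R4} {a : ℝ} (h : IsTransverse L a) (t : ℝ) :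
    IsTransverse (translateDiffeo t '' L) a :=
  h.image (fun p => Iff.rfl) fun p v _ hv => by rwa [fderiv_translateDiffeo]

theorem level_translate {L : Set R4} {a : ℝ} {S : Set R3} (h : level L a = incl a '' S) (t : ℝ) :
    level (translateDiffeo t '' L) a = incl a '' (translateThree t '' S) := by
  rw [level_image (b := a) fun p => Iff.rfl, h, image_image, image_image]
  rfl

theorem translate_mem_slices {S : Set R3} (h : S ∈ Slices) (t : ℝ) :
    translateThree t '' S ∈ Slices := by
  rcases h with ⟨hS, L, a, ha, hL, hLa, hl⟩ | rfl
  · exact Or.inl ⟨hS.translate t, translateDiffeo t '' L, a, ha,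
      hL.image (isSymplectic_translateDiffeo t) (translateDiffeo_image_L0 t), hLa.translate t,
      level_translate hl t⟩
  · exact Or.inr (image_empty _)

/-- The lift of a diffeomorphism of the `x₁`-line does not change slices over the region where the
latter is the identity. -/
theorem level_extendOne {L : Set R4} {a : ℝ} {S : Set R3} (hl : level L a = incl a '' S)
    (h : ℝ ≃ₘ[ℝ] ℝ) (hd : ∀ x, 0 < deriv h x) {s : Set ℝ} (hs : IsOpen s)
    (hh : ∀ x ∈ s, h x = x) (hS : ∀ p ∈ S, p.1 ∈ s) :
    level (extendOne (liftPlane h hd) '' L) a = incl a '' S := by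
  rw [level_image (b := a) fun p => Iff.rfl, hl, image_image]
  refine image_congr fun p hp => ?_
  have h1 : liftPlane h hd (p.1, p.2.2) = (p.1, p.2.2) := liftPlane_eq_self h hd hs hh (hS p hp)
  simp only [extendOne_apply, incl, h1]

theorem IsTransverse.extendOne {L : Set R4} {a : ℝ} (h : IsTransverse L a)
    (φ : (ℝ × ℝ) ≃ₘ[ℝ] (ℝ × ℝ)) : IsTransverse (extendOne φ '' L) a :=
  h.image (fun p => Iff.rfl) fun p v _ hv => by rwa [fderiv_extendOne]

/-- A slice in `{x₁ < 0}` is a slice of a Lagrangian that is flat outside `{x₁ < 0}`. -/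
theorem exists_lagrangian_left {L : Set R4} {a : ℝ} {S : Set R3} (hL : IsFlatPlanarLagrangian L)
    (hLa : IsTransverse L a) (hl : level L a = incl a '' S) (hS : IsCompact S)
    (hS0 : ∀ p ∈ S, p.1 < 0) :
    ∃ N K : Set R4, IsPlanarLagrangian N ∧ IsCompact K ∧ AgreesOutside N K ∧ (∀ p ∈ K, p.1 < 0) ∧
      IsTransverse N a ∧ level N a = incl a '' S := by
  obtain ⟨hP, K, hK, hLK⟩ := hL
  obtain ⟨R, hR0, hR⟩ := IsCompact.exists_abs_lt hK (f := fun z : R4 => z.1) (by fun_prop)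
  obtain ⟨ε, hε, hεS⟩ := IsCompact.exists_pos_lt hS (f := fun p : R3 => -p.1)
    (by fun_prop) fun p hp => neg_pos.2 (hS0 p hp)
  -- The slice lies in x₁ < -ε and stays fixed, while K is pressed to the left of -ε/2.
  obtain ⟨h, hd, h1, h2⟩ := exists_shift (u := -ε) (c := R) (c' := -ε / 2) (by linarith)
    (by linarith)
  refine ⟨extendOne (liftPlane h hd) '' L, extendOne (liftPlane h hd) '' K,
    hP.image (isSymplectic_extendOne (liftPlane_fderiv_det h hd)),
    hK.image (extendOne (liftPlane h hd)).contDiff.continuous,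
    hLK.image (extendOne_image_L0 h hd), ?_, hLa.extendOne _,
    level_extendOne hl h hd isOpen_Iio (fun x hx => h1 x (le_of_lt hx))
      fun p hp => mem_Iio.2 (by linarith [hεS p hp])⟩
  rintro _ ⟨z, hz, rfl⟩
  have h3 : h z.1 < h R := strictMono_of_deriv_pos hd (abs_lt.1 (hR z hz)).2
  rw [h2 R le_rfl] at h3
  rw [extendOne_apply, liftPlane_apply]
  simp only
  linarith

/-- A slice in `{x₁ > 0}` is a slice of a Lagrangian that is flat outside `{x₁ > 0}`. -/
theorem exists_lagrangian_right {L : Set R4} {a : ℝ} {S : Set R3} (hL : IsFlatPlanarLagrangian L)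
    (hLa : IsTransverse L a) (hl : level L a = incl a '' S) (hS : IsCompact S)
    (hS0 : ∀ p ∈ S, 0 < p.1) :
    ∃ N K : Set R4, IsPlanarLagrangian N ∧ IsCompact K ∧ AgreesOutside N K ∧ (∀ p ∈ K, 0 < p.1) ∧
      IsTransverse N a ∧ level N a = incl a '' S := by
  obtain ⟨hP, K, hK, hLK⟩ := hL
  obtain ⟨R, hR0, hR⟩ := IsCompact.exists_abs_lt hK (f := fun z : R4 => z.1) (by fun_prop)
  obtain ⟨ε, hε, hεS⟩ := IsCompact.exists_pos_lt hS (f := fun p : R3 => p.1) (by fun_prop) hS0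
  obtain ⟨h, hd, h1, h2⟩ := exists_shift_left (u := ε) (c := -R) (c' := ε / 2) (by linarith)
    (by linarith)
  refine ⟨extendOne (liftPlane h hd) '' L, extendOne (liftPlane h hd) '' K,
    hP.image (isSymplectic_extendOne (liftPlane_fderiv_det h hd)),
    hK.image (extendOne (liftPlane h hd)).contDiff.continuous,
    hLK.image (extendOne_image_L0 h hd), ?_, hLa.extendOne _,
    level_extendOne hl h hd isOpen_Ioi (fun x hx => h1 x (le_of_lt hx)) hεS⟩
  rintro _ ⟨z, hz, rfl⟩
  have h3 : h (-R) < h z.1 := strictMono_of_deriv_pos hd (abs_lt.1 (hR z hz)).1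
  rw [h2 (-R) le_rfl] at h3
  rw [extendOne_apply, liftPlane_apply]
  simp only
  linarith

theorem level_levelShift {L : Set R4} {a b : ℝ} {S : Set R3} (hl : level L b = incl b '' S)
    {ψ : R4 ≃ₘ[ℝ] R4} (hψ : ShiftsLevel ψ b a) (hψl : ∀ p, y2 (ψ p) = a ↔ y2 p = b) :
    level (ψ '' L) a = incl a '' S := by
  rw [level_image hψl, hl, image_image]
  refine image_congr fun p _ => ?_
  rw [hψ.2 (incl b p) le_rfl]
  simp [incl]

/-- The second Lagrangian is first shifted to level a. Once each is flat outside the half-space of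
its slice, the two halves join to a Lagrangian whose slice is the union. -/
theorem union_mem_slices {S S' : Set R3} (h : S ∈ Slices) (h' : S' ∈ Slices)
    (hS : ∀ p ∈ S, p.1 < 0) (hS' : ∀ p ∈ S', 0 < p.1) : S ∪ S' ∈ Slices := by
  have hc := isCompact_of_mem_slices h
  have hc' := isCompact_of_mem_slices h'
  rcases h with ⟨hSl, L, a, ha, hL, hLa, hl⟩ | rfl
  swap
  · rwa [empty_union]
  rcases h' with ⟨hSl', L', b, hb, hL', hLb', hl'⟩ | rfl
  swap
  · rw [union_empty]
    exact Or.inl ⟨hSl, L, a, ha, hL, hLa, hl⟩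
  obtain ⟨ψ, -, hψ, hψs, hψ0, -, hψl, hψd⟩ := exists_levelShift ha hb
  obtain ⟨N, K, hN, hK, hNK, hK0, hNa, hNl⟩ := exists_lagrangian_left hL hLa hl hc hS
  obtain ⟨N', K', hN', hK', hNK', hK0', hNa', hNl'⟩ := exists_lagrangian_right
    (hL'.image hψs hψ0) (hLb'.image hψl hψd) (level_levelShift hl' hψ hψl) hc' hS'
  obtain ⟨h1, h2, h3⟩ := halves_properties hN hN' hNK hNK' hK hK' hK0 hK0'
  refine Or.inl ⟨hSl.union hSl' ?_, halves N N', a, ha, h1, h2 a hNa hNa', ?_⟩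
  · rw [Set.disjoint_left]
    exact fun p hp hp' => (hS p hp).not_gt (hS' p hp')
  · rw [h3 a ha.ne, hNl, hNl', image_union]

/-! ### Classes of slices and connect sums -/

theorem Represents.translate {S : Set R3} {s : SliceClass} (h : Represents S s) (t : ℝ) :
    Represents (translateThree t '' S) s := by
  obtain ⟨hS, rfl⟩ := h
  exact ⟨translate_mem_slices hS t,
    Quotient.sound (sliceEquiv_symm (sliceEquiv_translate (isCompact_of_mem_slices hS) t))⟩

theorem Represents.sliceEquiv {S T : Set R3} {s : SliceClass} (h : Represents S s)
    (h' : Represents T s) : SliceEquiv S T := by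
  obtain ⟨hS, rfl⟩ := h
  obtain ⟨hT, e⟩ := h'
  exact sliceEquiv_symm (Quotient.exact e)

theorem Represents.isCompact {S : Set R3} {s : SliceClass} (h : Represents S s) : IsCompact S :=
  isCompact_of_mem_slices h.1

theorem exists_representsLeft (s : SliceClass) : ∃ S, RepresentsLeft S s := by
  obtain ⟨⟨S, hS⟩, rfl⟩ := Quotient.exists_rep s
  obtain ⟨R, -, hR⟩ := IsCompact.exists_abs_lt (isCompact_of_mem_slices hS)
    (f := fun p : R3 => p.1) (by fun_prop)
  refine ⟨translateThree (-R) '' S, Represents.translate ⟨hS, rfl⟩ _, ?_⟩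
  rintro _ ⟨p, hp, rfl⟩
  change p.1 + -R < 0
  linarith [(abs_lt.1 (hR p hp)).2]

theorem exists_representsRight (s : SliceClass) : ∃ S, RepresentsRight S s := by
  obtain ⟨⟨S, hS⟩, rfl⟩ := Quotient.exists_rep s
  obtain ⟨R, -, hR⟩ := IsCompact.exists_abs_lt (isCompact_of_mem_slices hS)
    (f := fun p : R3 => p.1) (by fun_prop)
  refine ⟨translateThree R '' S, Represents.translate ⟨hS, rfl⟩ _, ?_⟩
  rintro _ ⟨p, hp, rfl⟩
  change 0 < p.1 + R
  linarith [(abs_lt.1 (hR p hp)).1]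

theorem sliceEquiv_union_of_represents {s s' : SliceClass} {S T S' T' : Set R3}
    (hS : RepresentsLeft S s) (hT : RepresentsLeft T s) (hS' : RepresentsRight S' s')
    (hT' : RepresentsRight T' s') : SliceEquiv (S ∪ S') (T ∪ T') :=
  (hS.1.sliceEquiv hT.1).union (hS'.1.sliceEquiv hT'.1) hS.1.isCompact hT.1.isCompact
    hS'.1.isCompact hT'.1.isCompact (fun _ h => hS.2 h) (fun _ h => hT.2 h) (fun _ h => hS'.2 h)
    fun _ h => hT'.2 h

/-- The sum of two classes of slices. -/
theorem exists_sum (s s' : SliceClass) : ∃ r : SliceClass, ∀ S S' : Set R3,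
    RepresentsLeft S s → RepresentsRight S' s' → Represents (S ∪ S') r := by
  obtain ⟨T, hT⟩ := exists_representsLeft s
  obtain ⟨T', hT'⟩ := exists_representsRight s'
  have hmem : ∀ S S' : Set R3, RepresentsLeft S s → RepresentsRight S' s' → S ∪ S' ∈ Slices :=
    fun S S' hS hS' => union_mem_slices hS.1.1 hS'.1.1 (fun _ h => hS.2 h) fun _ h => hS'.2 h
  exact ⟨Quotient.mk sliceSetoid ⟨T ∪ T', hmem T T' hT hT'⟩, fun S S' hS hS' =>
    ⟨hmem S S' hS hS', Quotient.sound (sliceEquiv_union_of_represents hS hT hS' hT')⟩⟩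

theorem exists_isConnectSum {L L' : Set R4} (hL : IsFlatPlanarLagrangian L)
    (hL' : IsFlatPlanarLagrangian L') : ∃ M, IsConnectSum L L' M := by
  obtain ⟨-, K, hK, hLK⟩ := hL
  obtain ⟨-, K', hK', hLK'⟩ := hL'
  obtain ⟨R, -, hR⟩ := IsCompact.exists_abs_lt hK (f := fun p : R4 => p.1) (by fun_prop)
  obtain ⟨R', -, hR'⟩ := IsCompact.exists_abs_lt hK' (f := fun p : R4 => p.1) (by fun_prop)
  refine ⟨_, K, K', -R, R', hK, hLK, hK', hLK', ?_, ?_, rfl⟩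
  · rintro _ ⟨p, hp, rfl⟩
    change p.1 + -R < 0
    linarith [(abs_lt.1 (hR p hp)).2]
  · rintro _ ⟨p, hp, rfl⟩
    change 0 < p.1 + R'
    linarith [(abs_lt.1 (hR' p hp)).1]

/-- Outside K the set L is in level 0. Hence the condition on K in a connect sum also places the
slice in the correct half-space. -/
theorem mem_translate_of_level {L K : Set R4} (hLK : AgreesOutside L K) {a : ℝ} (ha : a ≠ 0)
    {S : Set R3} (hl : level L a = incl a '' S) {p : R3} (hp : p ∈ S) : incl a p ∈ K := by
  have h1 : incl a p ∈ level L a := hl ▸ mem_image_of_mem _ hp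
  by_contra h
  exact ha ((hLK.mem_iff h).1 h1.1).2

/-- The slice of M consists of translates of S and S', and translation does not change classes; so
any admissible choice of compact sets and translations gives the same sum. -/
theorem IsConnectSum.properties {L L' M : Set R4} {a : ℝ} (ha : a ≠ 0) {S S' : Set R3}
    {s s' : SliceClass} (hM : IsConnectSum L L' M) (hL : IsFlatPlanarLagrangian L)
    (hL' : IsFlatPlanarLagrangian L') (hLa : IsTransverse L a) (hLa' : IsTransverse L' a)
    (hl : level L a = incl a '' S) (hl' : level L' a = incl a '' S') (hS : Represents S s)
    (hS' : Represents S' s') :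
    IsFlatPlanarLagrangian M ∧ IsTransverse M a ∧ ∃ T T' : Set R3,
      level M a = incl a '' (T ∪ T') ∧ RepresentsLeft T s ∧ RepresentsRight T' s' := by
  obtain ⟨K, K', t, t', hK, hLK, hK', hLK', ht, ht', rfl⟩ := hM
  obtain ⟨h1, h2, h3⟩ := halves_properties
    (hL.1.image (isSymplectic_translateDiffeo t)) (hL'.1.image (isSymplectic_translateDiffeo t'))
    (hLK.image (translateDiffeo_image_L0 t)) (hLK'.image (translateDiffeo_image_L0 t'))
    (hK.image (translateDiffeo t).contDiff.continuous)
    (hK'.image (translateDiffeo t').contDiff.continuous) (fun p hp => ht hp) fun p hp => ht' hp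
  refine ⟨h1, h2 a (hLa.translate t) (hLa'.translate t'), translateThree t '' S,
    translateThree t' '' S', ?_, ⟨hS.translate t, ?_⟩, hS'.translate t', ?_⟩
  · rw [image_union, ← level_translate hl, ← level_translate hl']
    exact h3 a ha
  · rintro _ ⟨p, hp, rfl⟩
    exact ht (mem_image_of_mem _ (mem_translate_of_level hLK ha hl hp))
  · rintro _ ⟨p, hp, rfl⟩
    exact ht' (mem_image_of_mem _ (mem_translate_of_level hLK' ha hl' hp))

end PlanarSlices

theorem proposition2p1 :
    -- every class has representatives on either side
    (∀ s : PlanarSlices.SliceClass,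
      (∃ S, PlanarSlices.RepresentsLeft S s) ∧ ∃ S, PlanarSlices.RepresentsRight S s) ∧
    -- (1) the class of the union does not depend on the representatives
    (∀ (s s' : PlanarSlices.SliceClass) (S T S' T' : Set PlanarSlices.R3),
      PlanarSlices.RepresentsLeft S s → PlanarSlices.RepresentsLeft T s →
      PlanarSlices.RepresentsRight S' s' → PlanarSlices.RepresentsRight T' s' →
      PlanarSlices.SliceEquiv (S ∪ S') (T ∪ T')) ∧
    -- (2) the union is a slice, so that its class `r` is the sum of `s` and `s'` ...
    (∀ s s' : PlanarSlices.SliceClass, ∃ r : PlanarSlices.SliceClass,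
      (∀ S S' : Set PlanarSlices.R3, PlanarSlices.RepresentsLeft S s →
        PlanarSlices.RepresentsRight S' s' → PlanarSlices.Represents (S ∪ S') r) ∧
      -- ... and `r` is realized by connect sums, after a shift of levels
      ∀ (L L' : Set PlanarSlices.R4) (a b : ℝ) (S S' : Set PlanarSlices.R3),
        a < 0 → b < 0 →
        PlanarSlices.IsFlatPlanarLagrangian L → PlanarSlices.IsFlatPlanarLagrangian L' →
        PlanarSlices.IsTransverse L a → PlanarSlices.IsTransverse L' b →
        PlanarSlices.level L a = PlanarSlices.incl a '' S →
        PlanarSlices.level L' b = PlanarSlices.incl b '' S' →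
        PlanarSlices.Represents S s → PlanarSlices.Represents S' s' →
        ∃ ψ : PlanarSlices.R4 ≃ₘ[ℝ] PlanarSlices.R4,
          PlanarSlices.IsHamiltonianDiffeo ψ ∧ PlanarSlices.ShiftsLevel ψ b a ∧
          PlanarSlices.IsFlatPlanarLagrangian (ψ '' L') ∧
          (∃ M, PlanarSlices.IsConnectSum L (ψ '' L') M) ∧
          ∀ M, PlanarSlices.IsConnectSum L (ψ '' L') M →
            PlanarSlices.IsFlatPlanarLagrangian M ∧ PlanarSlices.IsTransverse M a ∧
            ∃ T : Set PlanarSlices.R3, PlanarSlices.level M a = PlanarSlices.incl a '' T ∧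
              PlanarSlices.Represents T r) := by
  open PlanarSlices in
  refine ⟨fun s => ⟨exists_representsLeft s, exists_representsRight s⟩,
    fun s s' S T S' T' hS hT hS' hT' => sliceEquiv_union_of_represents hS hT hS' hT',
    fun s s' => ?_⟩
  obtain ⟨r, hr⟩ := PlanarSlices.exists_sum s s'
  refine ⟨r, hr, fun L L' a b S S' ha hb hL hL' hLa hLb' hl hl' hS hS' => ?_⟩
  -- ψ depends on the levels a and b only. It preserves `L0`, so the image of L' is again flat at
  -- infinity.
  obtain ⟨ψ, hψH, hψ, hψs, hψ0, -, hψl, hψd⟩ := PlanarSlices.exists_levelShift ha hb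
  have hψL := hL'.image hψs hψ0
  refine ⟨ψ, hψH, hψ, hψL, PlanarSlices.exists_isConnectSum hL hψL, fun M hM => ?_⟩
  obtain ⟨h1, h2, T, T', h3, hT, hT'⟩ := hM.properties ha.ne hL hψL hLa (hLb'.image hψl hψd) hl
    (PlanarSlices.level_levelShift hl' hψ hψl) hS hS'
  exact ⟨h1, h2, T ∪ T', h3, hr T T' hT hT'⟩
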